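/- Let $k\ge 0$ be an integer, let $b,\sigma:\mathbb R\to\mathbb R$ be $1$-periodic and of class $C^{2k+2}$, and let $\Omega=(0,1)$ with periodic boundary conditions. For $M\ge 1$ put $\Delta x=1/M$ and let the mesh cells be $I_i=(i\Delta x,(i+1)\Delta x)$, $i\in\mathbb Z$. Let $V_k$ be the space of $u\in L^2(\Omega)$ whose restriction to each $I_i$, $0\le i<M$, is a polynomial of degree at most $k$; its elements are extended $1$-periodically. Let $(\cdot,\cdot)$ and $\|\cdot\|$ be the scalar product and norm of $L^2(\Omega)$, $\Pi$ the $L^2$ projection on $V_k$, and $M_p(\psi)=\max_{0\le r\le p}\|\psi^{(r)}\|_{L^\infty}$. For $h=\Delta t>0$ let $\gamma^q_h(x)=x+b(x)h+q\,\sigma(x)\sqrt h$. Consider either of the following two schemes. * SLDG-1: $q\in\{-1,1\}$, $\alpha_{\pm1}=\tfrac12$, $y^q_h=\gamma^q_h$. * SLDG-2 (Platen): $q\in\{-1,0,1\}$, $\alpha_{\pm1}=\tfrac16$, $\alpha_0=\tfrac23$ and $$y^q_h=x+\tfrac12\big(b(\gamma^{\sqrt3 q}_h)+b\big)h+\tfrac14\Big[\big(\sigma(\gamma^1_h)+\sigma(\gamma^{-1}_h)+2\sigma\big)\sqrt3\,q+\big(\sigma(\gamma^1_h)-\sigma(\gamma^{-1}_h)\big)(3q^2-1)\Big]\sqrt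 h .$$ For each $q$ choose a finite partition of $\Omega$ (up to finitely many points) into open intervals, each contained in some cell $I_i$ and mapped by $y^q_{\Delta t}$ into some cell $I_j$, $j\in\mathbb Z$. Let $(f,g)_{G^q}$ be obtained from $(f,g)$ by applying the $(k+1)$-point Gauss quadrature rule to $fg$ on each interval of this partition. Set $$S_{\Delta t}u=\Pi\Big(\sum_q\alpha_q\,u(y^q_{\Delta t}(\cdot))\Big),$$ and let $\widetilde S_{\Delta t}u\in V_k$ be the element of $V_k$ with $(\widetilde S_{\Delta t}u,\varphi)=\sum_q\alpha_q\,(u(y^q_{\Delta t}(\cdot)),\varphi)_{G^q}$ for all $\varphi\in V_k$. Let $\theta<1$. Then there is a constant $C\ge 0$, depending only on $k,b,\sigma,\theta$ and the scheme, such that the following holds for all $M\ge1$ and all $\Delta t>0$ with $$\big\|\Delta t\, b'+q\sqrt{\Delta t}\,\sigma'\big\|_{L^\infty}\le\theta\ \ (q=\pm1)\quad\text{for SLDG-1},\qquad \Delta t\,\|b'\|_{L^\infty}+3\sqrt{\Delta t}\,\|\sigma'\|_{L^\infty}\le\theta\quad\text{for SLDG-2}.$$ Partitions as above exist; and for every choice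 of them, the operators $S_{\Delta t}$ and $\widetilde S_{\Delta t}$ are well defined on all functions $u-\psi$ with $u\in V_k$ and $\psi\in C^{k+1}$ $1$-periodic, and: (i) for every $q$ and all $u,\varphi\in V_k$, $$\big|(u(y^q_{\Delta t}),\varphi)_{G^q}-(u(y^q_{\Delta t}),\varphi)\big|\le C\sqrt{\Delta t}\,\Delta x^2\,\|u\|\,\|\varphi\| ,$$ and, for every $u\in V_k$, $\ \|\widetilde S_{\Delta t}u-S_{\Delta t}u\|\le C\sqrt{\Delta t}\,\Delta x^2\,\|u\|$; (ii) for every $u\in V_k$ and every $1$-periodic $\psi\in C^{k+1}$, $$\|\widetilde S_{\Delta t}(u-\psi)-S_{\Delta t}(u-\psi)\|\le C\sqrt{\Delta t}\,\Delta x^2\,\|u-\psi\|+C\,M_{k+1}(\psi)\,\Delta x^{k+1};$$ (iii) for every $1$-periodic $\psi\in C^{k+1}$, $\ \|\widetilde S_{\Delta t}\psi-S_{\Delta t}\psi\|\le C\,M_{k+1}(\psi)\,\Delta x^{k+1}$. -/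

import Mathlib

open Polynomial

namespace SLDG

noncomputable section

/-- `x` and `w` are the nodes and the weights of the `(k + 1)`-point Gauss quadrature rule on
`(-1, 1)`: distinct nodes in the open interval, positive weights, and exactness for all polynomials
of degree at most `2 k + 1`. -/
def IsGaussRule (k : ℕ) (x w : Fin (k + 1) → ℝ) : Prop :=
  Function.Injective x ∧ (∀ a, x a ∈ Set.Ioo (-1 : ℝ) 1) ∧ (∀ a, 0 < w a) ∧
    ∀ p : ℝ[X], p.natDegree ≤ 2 * k + 1 →
      ∫ t in (-1 : ℝ)..1, p.eval t = ∑ a, w a * p.eval (x a)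

theorem integral_poly_pos (g : ℝ[X]) (hg : g ≠ 0) (h : ∀ x ∈ Set.Icc (-1 : ℝ) 1, 0 ≤ g.eval x) :
    0 < ∫ t in (-1 : ℝ)..1, g.eval t := by
  refine intervalIntegral.integral_pos (by norm_num) g.continuous.continuousOn
    (fun x hx => h x ⟨hx.1.le, hx.2⟩) ?_
  by_contra! hc
  refine hg (eq_zero_of_infinite_isRoot g
    ((Set.Icc_infinite (show (-1 : ℝ) < 1 by norm_num)).mono fun x hx => ?_))
  exact le_antisymm (hc x hx) (h x hx)

theorem exists_orthogonal_poly (n : ℕ) : ∃ p : ℝ[X], p.natDegree = n ∧ p ≠ 0 ∧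
    ∀ q : ℝ[X], q.degree < n → ∫ t in (-1 : ℝ)..1, p.eval t * q.eval t = 0 := by
  have hint : ∀ f : ℝ[X], IntervalIntegrable (fun t => f.eval t) MeasureTheory.volume (-1) 1 :=
    fun f => f.continuous.intervalIntegrable _ _
  let I : ℝ[X] →ₗ[ℝ] ℝ :=
    { toFun := fun f => ∫ t in (-1 : ℝ)..1, f.eval t
      map_add' := fun f g => by
        simp only [eval_add]; exact intervalIntegral.integral_add (hint f) (hint g)
      map_smul' := fun c f => by simp }
  let L : degreeLT ℝ (n + 1) →ₗ[ℝ] (Fin n → ℝ) :=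
    { toFun := fun p i => I ((p : ℝ[X]) * X ^ (i : ℕ))
      map_add' := fun f g => by ext i; simp [add_mul]
      map_smul' := fun c f => by ext i; simp }
  have hker : ¬ Function.Injective L := by
    intro hL
    have h1 := LinearMap.finrank_le_finrank_of_injective
      (f := L.comp (degreeLTEquiv ℝ (n + 1)).symm.toLinearMap)
      (hL.comp (degreeLTEquiv ℝ (n + 1)).symm.injective)
    simp at h1
  rw [← LinearMap.ker_eq_bot, Submodule.eq_bot_iff] at hker
  push Not at hker
  obtain ⟨⟨p, hp⟩, hpL, hp0⟩ := hker
  have hp0' : p ≠ 0 := fun h => hp0 (by ext1; exact h)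
  have horth : ∀ q : ℝ[X], q.degree < n → I (p * q) = 0 := by
    intro q hq
    rcases Nat.eq_zero_or_pos n with rfl | hn
    · have : q = 0 := by
        rw [← degree_eq_bot]; exact Nat.WithBot.lt_zero_iff.mp (by simpa using hq)
      simp [this]
    have hqd : q.natDegree < n := by
      by_cases h0 : q = 0
      · simpa [h0] using hn
      · exact (natDegree_lt_iff_degree_lt h0).2 hq
    rw [q.as_sum_range' n hqd, Finset.mul_sum, map_sum]
    refine Finset.sum_eq_zero fun i hi => ?_
    have := congrFun (LinearMap.mem_ker.1 hpL) ⟨i, Finset.mem_range.1 hi⟩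
    have h2 : p * monomial i (q.coeff i) = q.coeff i • (p * X ^ i) := by
      rw [← C_mul_X_pow_eq_monomial, smul_eq_C_mul]; ring
    rw [h2, map_smul]
    have h3 : I (p * X ^ i) = 0 := this
    simp [h3]
  refine ⟨p, ?_, hp0', ?_⟩
  · by_contra hne
    have hle : p.natDegree < n + 1 := (natDegree_lt_iff_degree_lt hp0').2 (mem_degreeLT.1 hp)
    have hlt : p.degree < n := (natDegree_lt_iff_degree_lt hp0').1 (by omega)
    have h1 : 0 < I (p * p) := integral_poly_pos (p * p) (mul_ne_zero hp0' hp0')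
      (fun x _ => by simpa using mul_self_nonneg _)
    exact h1.ne' (horth p hlt)
  · intro q hq
    have : I (p * q) = 0 := horth q hq
    simpa [I] using this

theorem exists_isGaussRule (k : ℕ) : ∃ x w : Fin (k + 1) → ℝ, IsGaussRule k x w := by
  obtain ⟨p, hpd, hp0, horth⟩ := exists_orthogonal_poly (k + 1)
  -- a factorisation `p = g * s` with `g` of constant sign and `s` of low degree is impossible
  have key : ∀ g s : ℝ[X], p = g * s → 0 < g.natDegree →
      ¬ (∀ x ∈ Set.Icc (-1 : ℝ) 1, 0 ≤ g.eval x) := by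
    intro g s hgs hgd hpos
    have hg0 : g ≠ 0 := by rintro rfl; simp at hgd
    have hs0 : s ≠ 0 := by rintro rfl; simp at hgs; exact hp0 hgs
    have hd : g.natDegree + s.natDegree = k + 1 := by
      rw [← hpd, hgs, natDegree_mul hg0 hs0]
    have h1 := horth s ((natDegree_lt_iff_degree_lt hs0).1 (by omega))
    have h2 := integral_poly_pos (g * s ^ 2) (mul_ne_zero hg0 (pow_ne_zero _ hs0)) (fun x hx => by
      simpa using mul_nonneg (hpos x hx) (sq_nonneg _))
    refine h2.ne' ?_
    rw [← h1]
    congr 1; ext t; rw [hgs]; simp; ring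
  have key' : ∀ g s : ℝ[X], p = g * s → 0 < g.natDegree →
      ¬ (∀ x ∈ Set.Icc (-1 : ℝ) 1, g.eval x ≤ 0) := by
    intro g s hgs hgd hneg
    exact key (-g) (-s) (by rw [hgs]; ring) (by simpa using hgd)
      (fun x hx => by simpa using hneg x hx)
  have hroots_mem : ∀ r ∈ p.roots, r ∈ Set.Ioo (-1 : ℝ) 1 := by
    intro r hr
    obtain ⟨s, hs⟩ := dvd_iff_isRoot.2 (isRoot_of_mem_roots hr)
    by_contra hc
    rw [Set.mem_Ioo, not_and_or, not_lt, not_lt] at hc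
    rcases hc with hc | hc
    · exact key _ s hs (by simp) (fun x hx => by simp; linarith [hx.1])
    · exact key' _ s hs (by simp) (fun x hx => by simp; linarith [hx.2])
  have hnodup : p.roots.Nodup := by
    rw [Multiset.nodup_iff_count_le_one]
    intro r
    by_contra hc
    rw [count_roots, not_le] at hc
    have : (X - C r) ^ 2 ∣ p := (le_rootMultiplicity_iff hp0).1 hc
    obtain ⟨s, hs⟩ := this
    exact key _ s hs (by rw [natDegree_pow]; simp) (fun x hx => by simpa using sq_nonneg _)
  have hsplit : p.Splits := by
    rw [splits_iff_splits]
    right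
    intro g hg hgp
    obtain ⟨s, hs⟩ := hgp
    by_contra hne
    have hd2 := hg.degree_le_two
    have hdpos : 0 < g.natDegree := hg.natDegree_pos
    have hnoroot : ∀ x, g.eval x ≠ 0 := by
      intro x hx
      exact hne (degree_eq_one_of_irreducible_of_root hg hx)
    rcases lt_or_gt_of_ne (hnoroot 0) with h0 | h0
    · refine key' g s hs hdpos fun x _ => ?_
      by_contra! hx
      obtain ⟨y, hy⟩ := mem_range_of_exists_le_of_exists_ge g.continuous ⟨0, h0.le⟩ ⟨x, hx.le⟩
      exact hnoroot y hy
    · refine key g s hs hdpos fun x _ => ?_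
      by_contra! hx
      obtain ⟨y, hy⟩ := mem_range_of_exists_le_of_exists_ge g.continuous ⟨x, hx.le⟩ ⟨0, h0.le⟩
      exact hnoroot y hy
  have hcard : p.roots.toFinset.card = k + 1 := by
    rw [Multiset.toFinset_card_of_nodup hnodup, splits_iff_card_roots.1 hsplit, hpd]
  let e := (p.roots.toFinset.equivFinOfCardEq hcard).symm
  let x : Fin (k + 1) → ℝ := fun a => (e a : ℝ)
  have hxinj : Function.Injective x := Subtype.val_injective.comp e.injective
  have hxroot : ∀ a, p.eval (x a) = 0 := fun a =>
    isRoot_of_mem_roots (Multiset.mem_toFinset.1 (e a).2)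
  let l : Fin (k + 1) → ℝ[X] := fun a => Lagrange.basis Finset.univ x a
  let w : Fin (k + 1) → ℝ := fun a => ∫ t in (-1 : ℝ)..1, (l a).eval t
  have hldeg : ∀ a, (l a).natDegree ≤ k := by
    intro a
    have := Lagrange.degree_basis (s := Finset.univ) (v := x) hxinj.injOn (Finset.mem_univ a)
    exact natDegree_le_of_degree_le (by rw [this]; simp)
  have hexact : ∀ q : ℝ[X], q.natDegree ≤ 2 * k + 1 →
      ∫ t in (-1 : ℝ)..1, q.eval t = ∑ a, w a * q.eval (x a) := by
    intro q hq
    have hdm := EuclideanDomain.div_add_mod q p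
    have hrdeg : (q % p).degree < (k + 1 : ℕ) := by
      have := degree_mod_lt q hp0
      rwa [degree_eq_natDegree hp0, hpd] at this
    have hqdeg : (q / p).degree < (k + 1 : ℕ) := by
      by_cases h0 : q / p = 0
      · rw [h0, degree_zero]; exact WithBot.bot_lt_coe _
      · refine (natDegree_lt_iff_degree_lt h0).1 ?_
        have hle : p.degree ≤ q.degree := by
          by_contra hlt
          exact h0 ((Polynomial.div_eq_zero_iff hp0).2 (not_le.1 hlt))
        have hadd := degree_add_div hp0 hle
        have hq0 : q ≠ 0 := by rintro rfl; simp at h0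
        rw [degree_eq_natDegree hp0, degree_eq_natDegree hq0, degree_eq_natDegree h0] at hadd
        have hadd' : p.natDegree + (q / p).natDegree = q.natDegree := by exact_mod_cast hadd
        omega
    have h1 := horth _ hqdeg
    have h2 : ∀ a, q.eval (x a) = (q % p).eval (x a) := by
      intro a
      conv_lhs => rw [← hdm]
      simp [hxroot]
    have h3 : ∀ t, q.eval t = p.eval t * (q / p).eval t + (q % p).eval t := by
      intro t
      conv_lhs => rw [← hdm]
      simp
    have h4 := Lagrange.eq_interpolate (s := Finset.univ) (v := x) (f := q % p) hxinj.injOn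
      (by simpa using hrdeg)
    have h5 : ∀ t, (q % p).eval t = ∑ a, (q % p).eval (x a) * (l a).eval t := by
      intro t
      conv_lhs => rw [h4]
      simp [Lagrange.interpolate_apply, eval_finsetSum, l]
    simp_rw [h2]
    have h6 : ∫ t in (-1 : ℝ)..1, q.eval t = ∫ t in (-1 : ℝ)..1, (q % p).eval t := by
      simp_rw [h3]
      have hi : IntervalIntegrable (fun t => p.eval t * (q / p).eval t)
          MeasureTheory.volume (-1) 1 :=
        (p.continuous.mul (q / p).continuous).intervalIntegrable _ _
      rw [intervalIntegral.integral_add hi ((q % p).continuous.intervalIntegrable _ _), h1,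
        zero_add]
    rw [h6]
    rw [intervalIntegral.integral_congr (fun t _ => h5 t), intervalIntegral.integral_finsetSum
      (fun a _ => ((l a).continuous.const_mul _).intervalIntegrable _ _)]
    refine Finset.sum_congr rfl fun a _ => ?_
    rw [intervalIntegral.integral_const_mul, mul_comm]
  refine ⟨x, w, hxinj, fun a => hroots_mem _ (Multiset.mem_toFinset.1 (e a).2), ?_, hexact⟩
  intro a
  have h1 := hexact (l a ^ 2) (by rw [natDegree_pow]; have := hldeg a; omega)
  have hself : (l a).eval (x a) = 1 := Lagrange.eval_basis_self hxinj.injOn (Finset.mem_univ a)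
  rw [Finset.sum_eq_single a] at h1
  · rw [eval_pow, hself, one_pow, mul_one] at h1
    rw [← h1]
    refine integral_poly_pos _ (pow_ne_zero _ ?_) (fun t _ => by simpa using sq_nonneg _)
    intro h0; rw [h0] at hself; simp at hself
  · intro c _ hca
    have : (l a).eval (x c) = 0 := Lagrange.eval_basis_of_ne hca.symm (Finset.mem_univ c)
    simp [this]
  · simp

/-- The Gauss nodes `x_0, …, x_k` in `(-1, 1)`. -/
def gaussNode (k : ℕ) : Fin (k + 1) → ℝ := (exists_isGaussRule k).choose

/-- The Gauss weights `w_0, …, w_k`. -/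
def gaussWeight (k : ℕ) : Fin (k + 1) → ℝ := (exists_isGaussRule k).choose_spec.choose

theorem isGaussRule_gauss (k : ℕ) : IsGaussRule k (gaussNode k) (gaussWeight k) :=
  (exists_isGaussRule k).choose_spec.choose_spec

/-- The `L²` norm on `Ω = (0, 1)`. -/
def l2norm (f : ℝ → ℝ) : ℝ := √(∫ x in (0 : ℝ)..1, f x ^ 2)

/-- The `L²` scalar product on `Ω = (0, 1)`. -/
def l2inner (f g : ℝ → ℝ) : ℝ := ∫ x in (0 : ℝ)..1, f x * g x

/-- The sup norm on `ℝ`. -/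
def supNorm (f : ℝ → ℝ) : ℝ := ⨆ x, |f x|

/-- `M_p(ψ)`, the largest sup norm of the derivatives of `ψ` of order `0, …, p`. -/
def derivBound (p : ℕ) (ψ : ℝ → ℝ) : ℝ := ⨆ r : Fin (p + 1), supNorm (iteratedDeriv r ψ)

/-- The mesh cell `(i Δx, (i + 1) Δx)`, `Δx = 1 / M`; the mesh is continued periodically to `ℝ`. -/
def cell (M : ℕ) (i : ℤ) : Set ℝ := Set.Ioo ((i : ℝ) / M) (((i : ℝ) + 1) / M)

/-- The discontinuous Galerkin space `V_k` on the uniform mesh of `(0, 1)` with `M` cells, whose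
elements are continued `1`-periodically to `ℝ`. An element is an `L²` function that is a polynomial
of degree at most `k` on each cell; we take its representative which has at the left end point of
a cell the value of the polynomial of this cell, so that equality in `V_k` is equality of
functions. -/
def dgSpace (k M : ℕ) : Submodule ℝ (ℝ → ℝ) where
  carrier := {u | Function.Periodic u 1 ∧ ∀ i : ℕ, i < M → ∃ p : ℝ[X], p.natDegree ≤ k ∧
    ∀ x ∈ Set.Ico ((i : ℝ) / M) (((i : ℝ) + 1) / M), u x = p.eval x}
  zero_mem' := ⟨fun _ => rfl, fun _ _ => ⟨0, by simp, by simp⟩⟩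
  add_mem' := by
    rintro u v ⟨hu, hu'⟩ ⟨hv, hv'⟩
    refine ⟨hu.add hv, fun i hi => ?_⟩
    obtain ⟨p, hp, hpu⟩ := hu' i hi
    obtain ⟨q, hq, hqv⟩ := hv' i hi
    exact ⟨p + q, natDegree_add_le_of_degree_le hp hq, fun x hx => by
      simp [hpu x hx, hqv x hx]⟩
  smul_mem' := by
    rintro c u ⟨hu, hu'⟩
    refine ⟨hu.smul c, fun i hi => ?_⟩
    obtain ⟨p, hp, hpu⟩ := hu' i hi
    exact ⟨c • p, (natDegree_smul_le c p).trans hp, fun x hx => by simp [hpu x hx]⟩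

/-- `v` is the `L²` projection of `w` on `V_k`: the element of `V_k` closest to `w`. -/
def IsProj (k M : ℕ) (w v : ℝ → ℝ) : Prop :=
  v ∈ dgSpace k M ∧ ∀ f ∈ dgSpace k M, l2norm (w - v) ≤ l2norm (w - f)

/-- The `L²` projection `Π` on `V_k`. -/
def proj (k M : ℕ) (w : ℝ → ℝ) : ℝ → ℝ := Classical.epsilon (IsProj k M w)

/-- A partition of `Ω` (up to finitely many points) into intervals `J_q = (pt q, pt (q + 1))`,
`q < n`, each of which lies in one mesh cell and is mapped by `y` into one mesh cell of the
periodic mesh. The `J_q` inside a fixed cell `I_i` are the intervals `J_{i,q}` of that cell. -/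
structure Partition (M : ℕ) (y : ℝ → ℝ) where
  n : ℕ
  pt : ℕ → ℝ
  pt_zero : pt 0 = 0
  pt_last : pt n = 1
  pt_lt : ∀ q < n, pt q < pt (q + 1)
  mem_cell : ∀ q < n, ∃ i : ℤ, Set.Ioo (pt q) (pt (q + 1)) ⊆ cell M i
  image_mem_cell : ∀ q < n, ∃ j : ℤ, y '' Set.Ioo (pt q) (pt (q + 1)) ⊆ cell M j

/-- The bilinear form `(f, g)_G`: the `(k + 1)`-point Gauss rule on each interval of the
partition. -/
def gaussForm (k : ℕ) {M : ℕ} {y : ℝ → ℝ} (P : Partition M y) (f g : ℝ → ℝ) : ℝ :=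
  ∑ q ∈ Finset.range P.n, ∑ a : Fin (k + 1),
    gaussWeight k a / 2 * (P.pt (q + 1) - P.pt q) *
      (f ((P.pt q + P.pt (q + 1)) / 2 + gaussNode k a * ((P.pt (q + 1) - P.pt q) / 2)) *
        g ((P.pt q + P.pt (q + 1)) / 2 + gaussNode k a * ((P.pt (q + 1) - P.pt q) / 2)))

/-- The two schemes: `one` is SLDG-1 (weak Euler), `two` is SLDG-2 (Platen). -/
inductive Scheme
  | one
  | two

/-- The values of `q` used by a scheme. -/
def Scheme.nodes : Scheme → Finset ℤ
  | .one => {-1, 1}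
  | .two => {-1, 0, 1}

/-- The weights `α_q`. -/
def Scheme.weight : Scheme → ℤ → ℝ
  | .one, _ => 1 / 2
  | .two, q => if q = 0 then 2 / 3 else 1 / 6

/-- `γ^q_h(x) = x + b(x) h + q σ(x) √h`. -/
def eulerChar (b σ : ℝ → ℝ) (h q x : ℝ) : ℝ := x + b x * h + q * σ x * √h

/-- The characteristics of Platen's second-order scheme. -/
def platenChar (b σ : ℝ → ℝ) (h q x : ℝ) : ℝ :=
  x + 1 / 2 * (b (eulerChar b σ h (√3 * q) x) + b x) * h
    + 1 / 4 * ((σ (eulerChar b σ h 1 x) + σ (eulerChar b σ h (-1) x) + 2 * σ x) * √3 * q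
      + (σ (eulerChar b σ h 1 x) - σ (eulerChar b σ h (-1) x)) * (3 * q ^ 2 - 1)) * √h

/-- The characteristics `y^q_h` of a scheme. -/
def Scheme.char : Scheme → (b σ : ℝ → ℝ) → (h : ℝ) → ℤ → ℝ → ℝ
  | .one, b, σ, h, q => eulerChar b σ h q
  | .two, b, σ, h, q => platenChar b σ h q

/-- The smallness condition on the time step under which the characteristics are one-to-one and
onto; the strict inequalities `< 1` hold with the margin given by `θ < 1`. -/
def Scheme.SmallStep : Scheme → (b σ : ℝ → ℝ) → (h θ : ℝ) → Prop
  | .one, b, σ, h, θ =>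
      supNorm (fun x => h * deriv b x + √h * deriv σ x) ≤ θ ∧
        supNorm (fun x => h * deriv b x - √h * deriv σ x) ≤ θ
  | .two, b, σ, h, θ => h * supNorm (deriv b) + 3 * √h * supNorm (deriv σ) ≤ θ

/-- The semi-discrete operator `u ↦ ∑_q α_q u(y^q_h(·))`. -/
def Scheme.semiDiscrete (s : Scheme) (b σ : ℝ → ℝ) (h : ℝ) (u : ℝ → ℝ) : ℝ → ℝ :=
  fun x => ∑ q : s.nodes, s.weight q * u (s.char b σ h q x)

/-- The scheme with exact integration, `S_h u = Π (∑_q α_q u(y^q_h(·)))`. -/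
def Scheme.exactOp (s : Scheme) (b σ : ℝ → ℝ) (h : ℝ) (k M : ℕ) (u : ℝ → ℝ) : ℝ → ℝ :=
  proj k M (s.semiDiscrete b σ h u)

/-- `v` is the element of `V_k` such that
`(v, φ) = ∑_q α_q (u(y^q_h(·)), φ)_{G^q}` for all `φ ∈ V_k`. -/
def Scheme.IsQuadImage (s : Scheme) (b σ : ℝ → ℝ) (h : ℝ) (k M : ℕ)
    (P : ∀ q : s.nodes, Partition M (s.char b σ h q)) (u v : ℝ → ℝ) : Prop :=
  v ∈ dgSpace k M ∧ ∀ φ ∈ dgSpace k M,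
    l2inner v φ = ∑ q : s.nodes, s.weight q *
      gaussForm k (P q) (fun x => u (s.char b σ h q x)) φ

/-- The fully discrete scheme `S̃_h`, which uses the Gauss rule on the partitions `P q`. -/
def Scheme.quadOp (s : Scheme) (b σ : ℝ → ℝ) (h : ℝ) (k M : ℕ)
    (P : ∀ q : s.nodes, Partition M (s.char b σ h q)) (u : ℝ → ℝ) : ℝ → ℝ :=
  Classical.epsilon (s.IsQuadImage b σ h k M P u)

end

end SLDG

open SLDG

namespace SLDG

/-! On each interval of a partition a test function φ is a polynomial of degree at most k, and the
Gauss rule is exact up to degree 2k + 1. Hence the quadrature error of (g, φ) is governed by the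
distance of g to polynomials of degree k + 1 on that interval. The rule and the integral are both
positive functionals, so a pointwise bound F for this distance, an inverse estimate for φ and
Cauchy–Schwarz give an error of at most C ‖F‖ ‖φ‖ (`exists_gaussForm_error_le`).

For (i), g = u ∘ y, and on an interval of the partition u is a polynomial of degree k in the scaled
variable t = M y(x) - j. Let L be the affine Taylor part of t and Q the quadratic term. Then L^n + n
L^(n-1) Q has degree at most n + 1 ≤ k + 1 and differs from t^n by O((t - L)² + |t - L - Q|). If ε
bounds the derivatives of y of order at least two, both terms are O(ε Δx²) (`exists_comp_approx`).
The coefficients of u are bounded by its root mean square over the cell, a function with the same L²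
norm as u, and y is removed by a change of variables, since y' ≥ 1 - θ.

Uniformity in Δt is `exists_isGoodChar`: the step condition gives y' ≥ 1 - θ, and ε = O(√Δt) because
the displacement y - x carries a factor Δt or √Δt in each term. The step condition bounds Δt unless
b and σ are constant, in which case ε = 0.

For (iii), the degree-k Taylor polynomial of ψ ∘ y is the approximant. For (ii), let T be the
cellwise Taylor polynomial of ψ: u - T falls under the argument for (i), and T - ψ is uniformly
O(Δx^(k+1)). Testing with the difference of the two operators carries the bounds from the bilinear
forms to the operators (`l2norm_quadOp_sub_exactOp_le`). -/

/-! ### Bounded measurable functions -/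

/-- Measurable and bounded functions on the line. -/
def IsBM (f : ℝ → ℝ) : Prop := Measurable f ∧ ∃ C, ∀ x, |f x| ≤ C

namespace IsBM

variable {f g : ℝ → ℝ}

theorem const (c : ℝ) : IsBM fun _ => c := ⟨measurable_const, |c|, fun _ => le_rfl⟩

theorem add (hf : IsBM f) (hg : IsBM g) : IsBM (f + g) := by
  obtain ⟨hf, A, hA⟩ := hf
  obtain ⟨hg, B, hB⟩ := hg
  exact ⟨hf.add hg, A + B, fun x => (abs_add_le _ _).trans (add_le_add (hA x) (hB x))⟩

theorem mul (hf : IsBM f) (hg : IsBM g) : IsBM (fun x => f x * g x) := by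
  obtain ⟨hf, A, hA⟩ := hf
  obtain ⟨hg, B, hB⟩ := hg
  refine ⟨hf.mul hg, A * B, fun x => ?_⟩
  rw [abs_mul]
  exact mul_le_mul (hA x) (hB x) (abs_nonneg _) ((abs_nonneg _).trans (hA x))

theorem const_mul (hf : IsBM f) (c : ℝ) : IsBM (fun x => c * f x) := (const c).mul hf

theorem sub (hf : IsBM f) (hg : IsBM g) : IsBM (f - g) := by
  have h := hf.add (hg.const_mul (-1))
  have e : f - g = f + fun x => -1 * g x := by ext x; simp [sub_eq_add_neg]
  rwa [e]

theorem sq (hf : IsBM f) : IsBM (fun x => f x ^ 2) := by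
  simpa only [pow_two] using hf.mul hf

theorem comp (hf : IsBM f) (hg : Measurable g) : IsBM (fun x => f (g x)) :=
  ⟨hf.1.comp hg, hf.2.imp fun _ h _ => h _⟩

theorem sum {ι : Type*} (s : Finset ι) {F : ι → ℝ → ℝ} (h : ∀ i ∈ s, IsBM (F i)) :
    IsBM (fun x => ∑ i ∈ s, F i x) := by
  classical
  induction s using Finset.induction_on with
  | empty => simpa using const 0
  | insert a s ha ih =>
    simp only [Finset.sum_insert ha]
    exact (h a (Finset.mem_insert_self _ _)).add
      (ih fun i hi => h i (Finset.mem_insert_of_mem hi))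

theorem intervalIntegrable (hf : IsBM f) (a b : ℝ) :
    IntervalIntegrable f MeasureTheory.volume a b := by
  obtain ⟨hm, C, hC⟩ := hf
  refine (intervalIntegrable_const (c := C)).mono_fun hm.aestronglyMeasurable ?_
  exact Filter.Eventually.of_forall fun x => by
    simpa using (hC x).trans (le_abs_self C)

theorem of_continuous_periodic (hf : Continuous f) (hp : Function.Periodic f 1) : IsBM f := by
  refine ⟨hf.measurable, ?_⟩
  obtain ⟨C, hC⟩ := (isCompact_Icc (a := (0 : ℝ)) (b := 1)).exists_bound_of_continuousOn
    hf.continuousOn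
  refine ⟨C, fun x => ?_⟩
  have h1 : f x = f (Int.fract x) := by
    rw [Int.fract]
    simpa using (hp.sub_int_mul_eq ⌊x⌋ (x := x)).symm
  rw [h1]
  exact hC _ ⟨Int.fract_nonneg _, (Int.fract_lt_one _).le⟩

end IsBM

/-! ### The L² product and norm on one period -/

variable {f g w : ℝ → ℝ}

theorem l2norm_nonneg (f : ℝ → ℝ) : 0 ≤ l2norm f := Real.sqrt_nonneg _

theorem l2norm_sq (f : ℝ → ℝ) : l2norm f ^ 2 = l2inner f f := by
  rw [l2norm, Real.sq_sqrt
    (intervalIntegral.integral_nonneg zero_le_one fun x _ => sq_nonneg _), l2inner]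
  simp only [pow_two]

theorem l2inner_comm (f g : ℝ → ℝ) : l2inner f g = l2inner g f := by
  simp only [l2inner, mul_comm]

theorem l2inner_add_left (hf : IsBM f) (hg : IsBM g) (hw : IsBM w) :
    l2inner (f + g) w = l2inner f w + l2inner g w := by
  simp only [l2inner, Pi.add_apply, add_mul]
  exact intervalIntegral.integral_add ((hf.mul hw).intervalIntegrable _ _)
    ((hg.mul hw).intervalIntegrable _ _)

theorem l2inner_sub_left (hf : IsBM f) (hg : IsBM g) (hw : IsBM w) :
    l2inner (f - g) w = l2inner f w - l2inner g w := by
  simp only [l2inner, Pi.sub_apply, sub_mul]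
  exact intervalIntegral.integral_sub ((hf.mul hw).intervalIntegrable _ _)
    ((hg.mul hw).intervalIntegrable _ _)

theorem l2inner_add_right (hf : IsBM f) (hg : IsBM g) (hw : IsBM w) :
    l2inner w (f + g) = l2inner w f + l2inner w g := by
  rw [l2inner_comm, l2inner_add_left hf hg hw, l2inner_comm f, l2inner_comm g]

theorem l2inner_sub_right (hf : IsBM f) (hg : IsBM g) (hw : IsBM w) :
    l2inner w (f - g) = l2inner w f - l2inner w g := by
  rw [l2inner_comm, l2inner_sub_left hf hg hw, l2inner_comm f, l2inner_comm g]

theorem l2inner_smul_left (c : ℝ) (f g : ℝ → ℝ) : l2inner (c • f) g = c * l2inner f g := by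
  simp only [l2inner, Pi.smul_apply, smul_eq_mul, mul_assoc, intervalIntegral.integral_const_mul]

theorem l2inner_smul_right (c : ℝ) (f g : ℝ → ℝ) : l2inner f (c • g) = c * l2inner f g := by
  rw [l2inner_comm, l2inner_smul_left, l2inner_comm]

theorem l2norm_sub_sq (hf : IsBM f) (hg : IsBM g) :
    l2norm (f - g) ^ 2 = l2norm f ^ 2 - 2 * l2inner f g + l2norm g ^ 2 := by
  simp only [l2norm_sq]
  rw [l2inner_sub_left hf hg (hf.sub hg), l2inner_sub_right hf hg hf, l2inner_sub_right hf hg hg,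
    l2inner_comm g f]
  ring

/-- Cauchy–Schwarz by the discriminant: ‖f - t g‖² is a quadratic in t without sign change. -/
theorem l2inner_le (hf : IsBM f) (hg : IsBM g) : l2inner f g ≤ l2norm f * l2norm g := by
  have h : ∀ t : ℝ, 0 ≤ l2norm g ^ 2 * (t * t) + (-2 * l2inner f g) * t + l2norm f ^ 2 := by
    intro t
    have h1 := l2norm_sub_sq hf (hg.const_mul t)
    have h2 : (fun x => t * g x) = t • g := rfl
    rw [h2, l2inner_smul_right, l2norm_sq (t • g), l2inner_smul_left, l2inner_smul_right,
      ← l2norm_sq] at h1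
    nlinarith [sq_nonneg (l2norm (f - t • g))]
  have h3 := discrim_le_zero h
  rw [discrim] at h3
  refine le_of_sq_le_sq ?_ (mul_nonneg (l2norm_nonneg f) (l2norm_nonneg g))
  nlinarith

theorem l2norm_add_le (hf : IsBM f) (hg : IsBM g) : l2norm (f + g) ≤ l2norm f + l2norm g := by
  refine le_of_sq_le_sq ?_ (add_nonneg (l2norm_nonneg f) (l2norm_nonneg g))
  have h := l2inner_le hf hg
  have h1 : l2norm (f + g) ^ 2 = l2norm f ^ 2 + 2 * l2inner f g + l2norm g ^ 2 := by
    simp only [l2norm_sq]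
    rw [l2inner_add_left hf hg (hf.add hg), l2inner_add_right hf hg hf,
      l2inner_add_right hf hg hg, l2inner_comm g f]
    ring
  nlinarith

theorem l2norm_mono (hf : IsBM f) (hg : IsBM g) (h : ∀ x, |f x| ≤ g x) :
    l2norm f ≤ l2norm g := by
  refine Real.sqrt_le_sqrt (intervalIntegral.integral_mono_on zero_le_one
    (hf.sq.intervalIntegrable _ _) (hg.sq.intervalIntegrable _ _) fun x _ => ?_)
  exact sq_le_sq.2 ((h x).trans (le_abs_self _))

theorem l2norm_const (c : ℝ) : l2norm (fun _ => c) = |c| := by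
  simp [l2norm, Real.sqrt_sq_eq_abs]

theorem l2norm_const_mul (c : ℝ) (f : ℝ → ℝ) : l2norm (fun x => c * f x) = |c| * l2norm f := by
  simp only [l2norm, mul_pow, intervalIntegral.integral_const_mul]
  rw [Real.sqrt_mul (sq_nonneg c), Real.sqrt_sq_eq_abs]

/-- A change of variables by a lift of a circle map whose derivative is at least `c`. -/
theorem l2norm_comp_le {y : ℝ → ℝ} {c : ℝ} (hc : 0 < c) (hy : Differentiable ℝ y)
    (hy1 : ∀ x, y (x + 1) = y x + 1) (hyd : ∀ x, c ≤ deriv y x) (hf : IsBM f)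
    (hp : Function.Periodic f 1) : √c * l2norm (fun x => f (y x)) ≤ l2norm f := by
  rw [l2norm, l2norm, ← Real.sqrt_mul hc.le]
  refine Real.sqrt_le_sqrt ?_
  have hy01 : y 1 = y 0 + 1 := by simpa using hy1 0
  have hpos : ∀ x ∈ Set.Ioo (0 : ℝ) 1, 0 ≤ deriv y x := fun x _ => hc.le.trans (hyd x)
  have hcv := MeasureTheory.integral_Icc_deriv_smul_of_deriv_nonneg (f := y) (f' := deriv y)
    (g := fun t => f t ^ 2)
    hy.continuous.continuousOn (fun x _ => (hy x).hasDerivAt) hpos zero_le_one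
  have hint := (MeasureTheory.integrableOn_Icc_deriv_smul_iff_of_deriv_nonneg (f := y)
    (f' := deriv y) (g := fun t => f t ^ 2)
    hy.continuous.continuousOn (fun x _ => (hy x).hasDerivAt) hpos zero_le_one).2 (by
      have := (intervalIntegrable_iff_integrableOn_Icc_of_le (by linarith)).1
        (hf.sq.intervalIntegrable (y 0) (y 1))
      exact this)
  -- The image of a period under y is again an interval of length one, over which the periodic f²
  -- has the same integral.
  have h1 : ∫ x in (0 : ℝ)..1, f x ^ 2 = ∫ x in (0 : ℝ)..1, deriv y x * f (y x) ^ 2 := by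
    have hper : Function.Periodic (fun x => f x ^ 2) 1 := fun x => by simp [hp x]
    have h2 := hper.intervalIntegral_add_eq 0 (y 0)
    rw [zero_add, ← hy01] at h2
    rw [h2, intervalIntegral.integral_of_le (by linarith),
      intervalIntegral.integral_of_le zero_le_one, ← MeasureTheory.integral_Icc_eq_integral_Ioc,
      ← MeasureTheory.integral_Icc_eq_integral_Ioc, ← hcv]
    simp
  rw [h1, ← intervalIntegral.integral_const_mul]
  refine intervalIntegral.integral_mono_on zero_le_one
    (((hf.comp hy.continuous.measurable).sq.const_mul c).intervalIntegrable _ _)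
    ((intervalIntegrable_iff_integrableOn_Icc_of_le zero_le_one).2 (by simpa using hint))
    fun x _ => mul_le_mul_of_nonneg_right (hyd x) (sq_nonneg _)


/-! ### Inverse estimates and cellwise root mean squares -/

/-- Equivalence of norms for polynomials of bounded degree: coefficients are controlled by the
`L²` norm on the unit interval. -/
theorem exists_coeff_le_l2norm (k : ℕ) : ∃ K : ℝ, 0 ≤ K ∧ ∀ (a : Fin (k + 1) → ℝ) (n : Fin (k + 1)),
    |a n| ≤ K * l2norm (fun t => ∑ i, a i * t ^ (i : ℕ)) := by
  let N : (Fin (k + 1) → ℝ) → ℝ := fun a => l2norm (fun t => ∑ i, a i * t ^ (i : ℕ))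
  have hcont : Continuous N := by
    refine Real.continuous_sqrt.comp ?_
    refine intervalIntegral.continuous_parametric_intervalIntegral_of_continuous'
      (f := fun (a : Fin (k + 1) → ℝ) t => (∑ i, a i * t ^ (i : ℕ)) ^ 2) ?_ 0 1
    simp only [Function.uncurry_def]
    fun_prop
  have hpos : ∀ a, a ≠ 0 → 0 < N a := by
    intro a ha
    let p : ℝ[X] := ∑ i : Fin (k + 1), C (a i) * X ^ (i : ℕ)
    have hpe : ∀ t, p.eval t = ∑ i, a i * t ^ (i : ℕ) := by
      intro t; simp [p, eval_finsetSum]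
    have hcoeff : ∀ i : Fin (k + 1), p.coeff i = a i := by
      intro i
      simp only [p, finsetSum_coeff, coeff_C_mul_X_pow]
      rw [Finset.sum_eq_single i]
      · simp
      · intro j _ hj
        rw [if_neg]
        exact fun h => hj (Fin.ext h.symm)
      · simp
    have hp0 : p ≠ 0 := by
      intro h0
      refine ha (funext fun i => ?_)
      rw [← hcoeff i, h0]; simp
    refine Real.sqrt_pos.2 ?_
    refine intervalIntegral.integral_pos zero_lt_one (by fun_prop) (fun x _ => sq_nonneg _) ?_
    by_contra! hc
    refine hp0 (eq_zero_of_infinite_isRoot p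
      ((Set.Icc_infinite (zero_lt_one' ℝ)).mono fun x hx => ?_))
    have h1 := hc x hx
    have h2 := pow_eq_zero_iff (two_ne_zero) |>.1 (le_antisymm h1 (sq_nonneg _))
    rw [Set.mem_ofPred_eq, IsRoot, hpe]
    exact h2
  -- N is continuous, homogeneous and positive off 0, so its minimum on the unit sphere of the sup
  -- norm is positive; its inverse is the constant.
  obtain ⟨a₀, ha₀, hmin⟩ := (isCompact_sphere (0 : Fin (k + 1) → ℝ) 1).exists_isMinOn
    (NormedSpace.sphere_nonempty.2 zero_le_one) hcont.continuousOn
  have ha₀0 : a₀ ≠ 0 := by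
    rintro rfl; simp at ha₀
  have hm := hpos a₀ ha₀0
  refine ⟨(N a₀)⁻¹, (inv_pos.2 hm).le, fun a n => ?_⟩
  by_cases ha : a = 0
  · subst ha
    simpa using mul_nonneg (inv_pos.2 hm).le (l2norm_nonneg _)
  have hna : 0 < ‖a‖ := norm_pos_iff.2 ha
  have h1 : N a₀ ≤ N (‖a‖⁻¹ • a) := hmin (by simp [norm_smul, hna.ne'])
  have h2 : N (‖a‖⁻¹ • a) = ‖a‖⁻¹ * N a := by
    have := l2norm_const_mul ‖a‖⁻¹ (fun t => ∑ i, a i * t ^ (i : ℕ))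
    rw [abs_of_pos (inv_pos.2 hna)] at this
    simp only [N]
    rw [← this]
    simp [Finset.mul_sum, mul_assoc]
  have h3 : |a n| ≤ ‖a‖ := norm_le_pi_norm a n
  rw [h2, ← div_eq_inv_mul, le_div_iff₀ hna] at h1
  rw [← div_eq_inv_mul, le_div_iff₀ hm]
  exact (mul_le_mul_of_nonneg_right h3 hm.le).trans (by rw [mul_comm]; exact h1)

/-- The root mean square of `u` over the mesh cell that contains `x`. -/
noncomputable def cellNorm (M : ℕ) (u : ℝ → ℝ) (x : ℝ) : ℝ :=
  √((M : ℝ) * ∫ t in (⌊(M : ℝ) * x⌋ : ℝ) / M..((⌊(M : ℝ) * x⌋ : ℝ) + 1) / M, u t ^ 2)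

variable {k M : ℕ} {u : ℝ → ℝ}

theorem floor_mul_eq_iff (hM : 1 ≤ M) {x : ℝ} {j : ℤ} :
    ⌊(M : ℝ) * x⌋ = j ↔ x ∈ Set.Ico ((j : ℝ) / M) (((j : ℝ) + 1) / M) := by
  have hM' : (0 : ℝ) < M := by exact_mod_cast hM
  rw [Int.floor_eq_iff, Set.mem_Ico, div_le_iff₀ hM', lt_div_iff₀ hM', mul_comm]

theorem floor_mul_of_mem_cell (hM : 1 ≤ M) {x : ℝ} {j : ℤ} (hx : x ∈ cell M j) :
    ⌊(M : ℝ) * x⌋ = j := (floor_mul_eq_iff hM).2 ⟨hx.1.le, hx.2⟩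

theorem cellNorm_congr {x x' : ℝ} (h : ⌊(M : ℝ) * x⌋ = ⌊(M : ℝ) * x'⌋) :
    cellNorm M u x = cellNorm M u x' := by rw [cellNorm, h, ← cellNorm]

theorem cellNorm_nonneg (M : ℕ) (u : ℝ → ℝ) (x : ℝ) : 0 ≤ cellNorm M u x := Real.sqrt_nonneg _

theorem cellNorm_periodic (hM : 1 ≤ M) (hp : Function.Periodic u 1) :
    Function.Periodic (cellNorm M u) 1 := by
  intro x
  have hM' : (M : ℝ) ≠ 0 := by positivity
  have h1 : ⌊(M : ℝ) * (x + 1)⌋ = ⌊(M : ℝ) * x⌋ + M := by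
    rw [mul_add, mul_one]; exact_mod_cast Int.floor_add_natCast _ _
  have h2 : ∀ c : ℝ, (c + M) / M = c / M + 1 := fun c => by field_simp
  rw [cellNorm, cellNorm, h1]
  push_cast
  rw [h2, add_right_comm, h2, ← intervalIntegral.integral_comp_add_right]
  simp only [hp _]

theorem cellNorm_measurable (M : ℕ) (u : ℝ → ℝ) : Measurable (cellNorm M u) := by
  let G : ℤ → ℝ := fun j => √((M : ℝ) * ∫ t in (j : ℝ) / M..((j : ℝ) + 1) / M, u t ^ 2)
  have : cellNorm M u = G ∘ fun x => ⌊(M : ℝ) * x⌋ := rfl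
  rw [this]
  exact (measurable_of_countable G).comp (measurable_id.const_mul _).floor

/-- Expansion in the scaled monomials of a cell. -/
theorem exists_cell_expansion (hM : 1 ≤ M) (hu : u ∈ dgSpace k M) (j : ℤ) :
    ∃ a : Fin (k + 1) → ℝ, ∀ x, ⌊(M : ℝ) * x⌋ = j →
      u x = ∑ n, a n * ((M : ℝ) * x - j) ^ (n : ℕ) := by
  have hM' : (0 : ℝ) < M := by exact_mod_cast hM
  have hMz : (0 : ℤ) < M := by exact_mod_cast hM
  obtain ⟨hper, hloc⟩ := hu
  -- Membership in V_k gives polynomials only for cells of the period [0, 1), so the cell j is moved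
  -- there: i = j mod M.
  obtain ⟨i, hi⟩ := Int.eq_ofNat_of_zero_le (Int.emod_nonneg j hMz.ne')
  have hi' : i < M := by
    have := Int.emod_lt_of_pos j hMz
    omega
  have hji : (j : ℝ) = M * (j / (M : ℤ) : ℤ) + i := by
    have := Int.mul_ediv_add_emod j M
    rw [hi] at this
    exact_mod_cast this.symm
  obtain ⟨p, hpd, hp⟩ := hloc i hi'
  let q : ℝ[X] := p.comp (C ((i : ℝ) / M) + C (1 / (M : ℝ)) * X)
  have hqd : q.natDegree < k + 1 := by
    refine Nat.lt_succ_of_le (natDegree_comp_le.trans ?_)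
    have h1 : (C ((i : ℝ) / M) + C (1 / (M : ℝ)) * X).natDegree ≤ 1 := by compute_degree
    calc _ ≤ k * 1 := Nat.mul_le_mul hpd h1
      _ = k := mul_one k
  refine ⟨fun n => q.coeff n, fun x hx => ?_⟩
  have h1 : u x = u (x - (j / (M : ℤ) : ℤ)) := by
    simpa using (hper.sub_int_mul_eq (j / (M : ℤ)) (x := x)).symm
  rw [floor_mul_eq_iff hM, Set.mem_Ico, div_le_iff₀ hM', lt_div_iff₀ hM', hji] at hx
  have hx1 := hx.1
  have hx2 := hx.2
  rw [h1, hp _ (by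
    rw [Set.mem_Ico, div_le_iff₀ hM', lt_div_iff₀ hM']
    constructor <;> linarith)]
  have h2 : p.eval (x - (j / (M : ℤ) : ℤ)) = q.eval ((M : ℝ) * x - j) := by
    simp only [q, eval_comp, eval_add, eval_mul, eval_C, eval_X]
    congr 1
    rw [hji]; field_simp; ring
  rw [h2, eval_eq_sum_range' hqd, Finset.sum_range]

theorem cellNorm_eq_of_expansion (hM : 1 ≤ M) {j : ℤ} {a : Fin (k + 1) → ℝ}
    (ha : ∀ x, ⌊(M : ℝ) * x⌋ = j → u x = ∑ n, a n * ((M : ℝ) * x - j) ^ (n : ℕ))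
    {x : ℝ} (hx : ⌊(M : ℝ) * x⌋ = j) :
    cellNorm M u x = l2norm (fun t => ∑ i, a i * t ^ (i : ℕ)) := by
  have hM' : (0 : ℝ) < M := by exact_mod_cast hM
  rw [cellNorm, l2norm, hx]
  congr 1
  have h1 : (j : ℝ) / M ≤ ((j : ℝ) + 1) / M := by gcongr; linarith
  have h2 : ∫ t in (j : ℝ) / M..((j : ℝ) + 1) / M, u t ^ 2 =
      ∫ t in (j : ℝ) / M..((j : ℝ) + 1) / M,
        (fun s => (∑ n, a n * s ^ (n : ℕ)) ^ 2) ((M : ℝ) * t - j) := by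
    refine intervalIntegral.integral_congr_Ioo_of_le h1 fun t ht => ?_
    rw [ha t (floor_mul_of_mem_cell hM ht)]
  rw [h2]
  refine (intervalIntegral.mul_integral_comp_mul_sub
    (f := fun s => (∑ n, a n * s ^ (n : ℕ)) ^ 2) (M : ℝ) j).trans ?_
  rw [mul_div_cancel₀ _ hM'.ne', mul_div_cancel₀ _ hM'.ne', sub_self, add_sub_cancel_left]

/-- The cell expansion with its coefficients bounded by the root mean square over the cell. -/
theorem exists_cell_expansion_le (k : ℕ) : ∃ K : ℝ, 0 ≤ K ∧ ∀ (M : ℕ) (u : ℝ → ℝ), 1 ≤ M →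
    u ∈ dgSpace k M → ∀ j : ℤ, ∃ a : Fin (k + 1) → ℝ,
      (∀ x, ⌊(M : ℝ) * x⌋ = j → u x = ∑ n, a n * ((M : ℝ) * x - j) ^ (n : ℕ)) ∧
      ∀ n x, ⌊(M : ℝ) * x⌋ = j → |a n| ≤ K * cellNorm M u x := by
  obtain ⟨K, hK, h⟩ := exists_coeff_le_l2norm k
  refine ⟨K, hK, fun M u hM hu j => ?_⟩
  obtain ⟨a, ha⟩ := exists_cell_expansion hM hu j
  exact ⟨a, ha, fun n x hx => by rw [cellNorm_eq_of_expansion hM ha hx]; exact h a n⟩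

/-- Inverse estimate: the scaled monomials are at most 1 on their cell, so the sum of the
coefficient bounds suffices. The constant does not depend on the mesh. -/
theorem exists_abs_le_cellNorm (k : ℕ) : ∃ K : ℝ, 0 ≤ K ∧ ∀ (M : ℕ) (u : ℝ → ℝ), 1 ≤ M →
    u ∈ dgSpace k M → ∀ x, |u x| ≤ K * cellNorm M u x := by
  obtain ⟨K, hK, h⟩ := exists_cell_expansion_le k
  refine ⟨(k + 1) * K, by positivity, fun M u hM hu x => ?_⟩
  obtain ⟨a, ha, hle⟩ := h M u hM hu ⌊(M : ℝ) * x⌋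
  rw [ha x rfl]
  calc _ ≤ ∑ n, |a n * ((M : ℝ) * x - ⌊(M : ℝ) * x⌋) ^ (n : ℕ)| := Finset.abs_sum_le_sum_abs _ _
    _ ≤ ∑ _n : Fin (k + 1), K * cellNorm M u x := by
        refine Finset.sum_le_sum fun n _ => ?_
        rw [abs_mul, abs_pow]
        have h1 : |(M : ℝ) * x - ⌊(M : ℝ) * x⌋| ≤ 1 := by
          rw [← Int.fract, abs_of_nonneg (Int.fract_nonneg _)]
          exact (Int.fract_lt_one _).le
        calc _ ≤ |a n| * 1 := by
              gcongr; exact pow_le_one₀ (abs_nonneg _) h1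
          _ ≤ _ := by rw [mul_one]; exact hle n x rfl
    _ = _ := by simp; ring

/-- A function that is given on each cell by a measurable formula is measurable. -/
theorem measurable_of_cellwise {F : ℤ → ℝ → ℝ} (hF : ∀ j, Measurable (F j))
    (h : ∀ x, u x = F ⌊(M : ℝ) * x⌋ x) : Measurable u := by
  have h1 : Measurable fun p : ℤ × ℝ => F p.1 p.2 := measurable_from_prod_countable_right hF
  have h2 : u = (fun p : ℤ × ℝ => F p.1 p.2) ∘ fun x => (⌊(M : ℝ) * x⌋, x) := funext h
  rw [h2]
  exact h1.comp ((measurable_id.const_mul _).floor.prodMk measurable_id)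

theorem IsBM.of_mem_dgSpace (hM : 1 ≤ M) (hu : u ∈ dgSpace k M) : IsBM u := by
  have hM' : (0 : ℝ) < M := by exact_mod_cast hM
  choose a ha using exists_cell_expansion hM hu
  refine ⟨measurable_of_cellwise (M := M)
    (F := fun j x => ∑ n, a j n * ((M : ℝ) * x - j) ^ (n : ℕ)) (fun j => by fun_prop)
    (fun x => ha _ x rfl), ?_⟩
  refine ⟨∑ i ∈ Finset.range M, ∑ n, |a i n|, fun x => ?_⟩
  have h1 : u x = u (Int.fract x) := by
    rw [Int.fract]
    simpa using (hu.1.sub_int_mul_eq ⌊x⌋ (x := x)).symm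
  have h0 : 0 ≤ ⌊(M : ℝ) * Int.fract x⌋ :=
    Int.floor_nonneg.2 (mul_nonneg hM'.le (Int.fract_nonneg _))
  obtain ⟨i, hi⟩ := Int.eq_ofNat_of_zero_le h0
  have hiM : i < M := by
    have : ⌊(M : ℝ) * Int.fract x⌋ < (M : ℤ) := by
      rw [Int.floor_lt]
      have := mul_lt_mul_of_pos_left (Int.fract_lt_one x) hM'
      push_cast; linarith
    omega
  rw [h1, ha i _ hi]
  calc _ ≤ ∑ n, |a i n * ((M : ℝ) * Int.fract x - (i : ℤ)) ^ (n : ℕ)| :=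
        Finset.abs_sum_le_sum_abs _ _
    _ ≤ ∑ n, |a i n| := by
        refine Finset.sum_le_sum fun n _ => ?_
        rw [abs_mul, abs_pow]
        refine mul_le_of_le_one_right (abs_nonneg _) (pow_le_one₀ (abs_nonneg _) ?_)
        have h2 := Int.fract_nonneg ((M : ℝ) * Int.fract x)
        have h3 := (Int.fract_lt_one ((M : ℝ) * Int.fract x)).le
        rw [Int.fract, hi] at h2 h3
        rw [abs_of_nonneg]
        · exact_mod_cast h3
        · exact_mod_cast h2
    _ ≤ _ := Finset.single_le_sum (f := fun i : ℕ => ∑ n, |a i n|)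
        (fun i _ => Finset.sum_nonneg fun n _ => abs_nonneg _) (Finset.mem_range.2 hiM)

theorem cellNorm_le (hM : 1 ≤ M) (hp : Function.Periodic u 1) (hu : IsBM u) (x : ℝ) :
    cellNorm M u x ≤ √M * l2norm u := by
  have hM' : (0 : ℝ) < M := by exact_mod_cast hM
  have hM1 : (1 : ℝ) ≤ M := by exact_mod_cast hM
  rw [cellNorm, l2norm, ← Real.sqrt_mul hM'.le]
  refine Real.sqrt_le_sqrt (mul_le_mul_of_nonneg_left ?_ hM'.le)
  have hper : Function.Periodic (fun x => u x ^ 2) 1 := fun x => by simp [hp x]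
  have h2 := hper.intervalIntegral_add_eq 0 ((⌊(M : ℝ) * x⌋ : ℝ) / M)
  rw [zero_add] at h2
  rw [h2]
  have h3 : 1 / (M : ℝ) ≤ 1 := by rw [div_le_one hM']; exact hM1
  have h4 : 0 < 1 / (M : ℝ) := by positivity
  refine intervalIntegral.integral_mono_interval le_rfl ?_ ?_ ?_ (hu.sq.intervalIntegrable _ _)
  · rw [add_div]; linarith
  · rw [add_div]; linarith
  · exact Filter.Eventually.of_forall fun t => sq_nonneg _

theorem IsBM.cellNorm (hM : 1 ≤ M) (hp : Function.Periodic u 1) (hu : IsBM u) :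
    IsBM (cellNorm M u) :=
  ⟨cellNorm_measurable M u, √M * l2norm u, fun x => by
    rw [abs_of_nonneg (cellNorm_nonneg M u x)]; exact cellNorm_le hM hp hu x⟩

/-- On each cell the square of `cellNorm` is constant, equal to the mean of u², so both squares have
the same integral cell by cell. -/
theorem l2norm_cellNorm (hM : 1 ≤ M) (hu : IsBM u) : l2norm (cellNorm M u) = l2norm u := by
  have hM' : (0 : ℝ) < M := by exact_mod_cast hM
  rw [l2norm, l2norm]
  congr 1
  have hsum : ∀ f : ℝ → ℝ, (∀ i : ℕ, IntervalIntegrable f MeasureTheory.volume ((i : ℝ) / M)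
      (((i + 1 : ℕ) : ℝ) / M)) → ∫ x in (0 : ℝ)..1, f x =
      ∑ i ∈ Finset.range M, ∫ x in (i : ℝ) / M..((i : ℝ) + 1) / M, f x := by
    intro f hf
    have := intervalIntegral.sum_integral_adjacent_intervals (f := f)
      (μ := MeasureTheory.volume) (a := fun i : ℕ => (i : ℝ) / M) (n := M) (fun i _ => hf i)
    simp only [Nat.cast_zero, zero_div, div_self hM'.ne'] at this
    rw [← this]; push_cast; rfl
  have hcell : ∀ i : ℕ, ∀ x ∈ Set.Ioo ((i : ℝ) / M) (((i : ℝ) + 1) / M),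
      cellNorm M u x ^ 2 = M * ∫ t in (i : ℝ) / M..((i : ℝ) + 1) / M, u t ^ 2 := by
    intro i x hx
    have hfl : ⌊(M : ℝ) * x⌋ = (i : ℤ) := floor_mul_of_mem_cell hM (by simpa [cell] using hx)
    rw [SLDG.cellNorm, hfl, Real.sq_sqrt]
    · simp
    · refine mul_nonneg hM'.le (intervalIntegral.integral_nonneg ?_ fun x _ => sq_nonneg _)
      gcongr; linarith
  have hint : ∀ i : ℕ, ∫ x in (i : ℝ) / M..((i : ℝ) + 1) / M, cellNorm M u x ^ 2 =
      ∫ x in (i : ℝ) / M..((i : ℝ) + 1) / M,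
        (M : ℝ) * ∫ t in (i : ℝ) / M..((i : ℝ) + 1) / M, u t ^ 2 := fun i =>
    intervalIntegral.integral_congr_Ioo_of_le (by gcongr; linarith) (hcell i)
  rw [hsum _ fun i => hu.sq.intervalIntegrable _ _, hsum]
  · refine Finset.sum_congr rfl fun i _ => ?_
    rw [hint, intervalIntegral.integral_const, smul_eq_mul]
    field_simp
    ring
  · intro i
    have hle : (i : ℝ) / M ≤ ((i + 1 : ℕ) : ℝ) / M := by gcongr; simp
    rw [intervalIntegrable_iff_integrableOn_Ioo_of_le hle]
    refine (MeasureTheory.integrableOn_const (C := (M : ℝ) *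
      ∫ t in (i : ℝ) / M..((i : ℝ) + 1) / M, u t ^ 2) (by simp)).congr_fun ?_ measurableSet_Ioo
    intro x hx
    exact (hcell i x (by simpa using hx)).symm

/-- The inverse estimate holds at every point, including the left end points of cells, so the
conclusion is not merely almost everywhere. It makes the L² product definite on V_k. -/
theorem eq_zero_of_l2norm_eq_zero (hM : 1 ≤ M) (hu : u ∈ dgSpace k M) (h : l2norm u = 0) :
    u = 0 := by
  obtain ⟨K, hK, hle⟩ := exists_abs_le_cellNorm k
  ext x
  have h1 := hle M u hM hu x
  have h2 := cellNorm_le hM hu.1 (IsBM.of_mem_dgSpace hM hu) x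
  rw [h, mul_zero] at h2
  have h3 : |u x| ≤ 0 := h1.trans (mul_nonpos_of_nonneg_of_nonpos hK h2)
  simpa using h3


/-! ### Error of the Gauss rule -/

theorem sum_gaussWeight (k : ℕ) : ∑ a, gaussWeight k a = 2 := by
  have h := (isGaussRule_gauss k).2.2.2 1 (by simp)
  simp at h
  linarith

theorem gaussPoint_mem {a b : ℝ} (hab : a < b) (i : Fin (k + 1)) :
    (a + b) / 2 + gaussNode k i * ((b - a) / 2) ∈ Set.Ioo a b := by
  obtain ⟨h1, h2⟩ := (isGaussRule_gauss k).2.1 i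
  constructor <;> nlinarith

theorem gauss_exact (a b : ℝ) {p : ℝ[X]} (hp : p.natDegree ≤ 2 * k + 1) :
    ∫ t in a..b, p.eval t = ∑ i, gaussWeight k i / 2 * (b - a) *
      p.eval ((a + b) / 2 + gaussNode k i * ((b - a) / 2)) := by
  let q : ℝ[X] := p.comp (C ((b - a) / 2) * X + C ((a + b) / 2))
  have hq : q.natDegree ≤ 2 * k + 1 := by
    refine natDegree_comp_le.trans ?_
    have h1 : (C ((b - a) / 2) * X + C ((a + b) / 2)).natDegree ≤ 1 := by compute_degree
    calc _ ≤ (2 * k + 1) * 1 := Nat.mul_le_mul hp h1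
      _ = _ := mul_one _
  have hqe : ∀ t, q.eval t = p.eval ((b - a) / 2 * t + (a + b) / 2) := by
    intro t; simp [q, eval_comp]
  have h := (isGaussRule_gauss k).2.2.2 q hq
  simp only [hqe] at h
  have h1 := intervalIntegral.mul_integral_comp_mul_add (a := -1) (b := 1)
    (f := fun t => p.eval t) ((b - a) / 2) ((a + b) / 2)
  rw [h, Finset.mul_sum] at h1
  rw [show a = (b - a) / 2 * -1 + (a + b) / 2 by ring,
    show b = (b - a) / 2 * 1 + (a + b) / 2 by ring]
  refine Eq.trans ?_ (h1.symm.trans ?_)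
  · congr 1; ring_nf
  · refine Finset.sum_congr rfl fun i _ => ?_
    have e : (b - a) / 2 * gaussNode k i + (a + b) / 2 =
      (a + b) / 2 + gaussNode k i * ((b - a) / 2) := by ring
    rw [e]
    ring_nf

/-- The error of the Gauss rule on one interval. -/
theorem gauss_error_le {a b : ℝ} (hab : a < b) {f : ℝ → ℝ} (hf : IsBM f) {p : ℝ[X]}
    (hp : p.natDegree ≤ 2 * k + 1) {η : ℝ} (h : ∀ x ∈ Set.Ioo a b, |f x - p.eval x| ≤ η) :
    |(∑ i, gaussWeight k i / 2 * (b - a) * f ((a + b) / 2 + gaussNode k i * ((b - a) / 2)))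
      - ∫ t in a..b, f t| ≤ 2 * ((b - a) * η) := by
  have hba : 0 < b - a := sub_pos.2 hab
  -- The rule and the integral agree on p, and both are positive with total mass b - a; each
  -- contributes one error (b - a) η.
  have h1 : |(∑ i, gaussWeight k i / 2 * (b - a) *
      f ((a + b) / 2 + gaussNode k i * ((b - a) / 2))) - ∫ t in a..b, p.eval t| ≤ (b - a) * η := by
    rw [gauss_exact a b hp, ← Finset.sum_sub_distrib]
    calc _ ≤ ∑ i, |gaussWeight k i / 2 * (b - a) *
              f ((a + b) / 2 + gaussNode k i * ((b - a) / 2)) - gaussWeight k i / 2 * (b - a) *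
              p.eval ((a + b) / 2 + gaussNode k i * ((b - a) / 2))| :=
            Finset.abs_sum_le_sum_abs _ _
      _ ≤ ∑ i, gaussWeight k i * ((b - a) * η / 2) := by
          refine Finset.sum_le_sum fun i _ => ?_
          have hw := (isGaussRule_gauss k).2.2.1 i
          rw [← mul_sub, abs_mul, abs_of_pos (by positivity)]
          have := mul_le_mul_of_nonneg_left (h _ (gaussPoint_mem hab i))
            (show 0 ≤ gaussWeight k i / 2 * (b - a) by positivity)
          linarith
      _ = _ := by rw [← Finset.sum_mul, sum_gaussWeight]; ring
  have hpi : IntervalIntegrable (fun t => p.eval t) MeasureTheory.volume a b :=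
    p.continuous.intervalIntegrable _ _
  have h2 : |(∫ t in a..b, p.eval t) - ∫ t in a..b, f t| ≤ (b - a) * η := by
    rw [← intervalIntegral.integral_sub hpi (hf.intervalIntegrable _ _)]
    have hcst : ∀ c : ℝ, ∫ _ in a..b, c = (b - a) * c := fun c => by simp
    rw [abs_le]
    constructor
    · rw [← mul_neg, ← hcst]
      refine intervalIntegral.integral_mono_on_of_le_Ioo hab.le intervalIntegrable_const
        (hpi.sub (hf.intervalIntegrable _ _)) fun x hx => ?_
      have := (abs_le.1 (h x hx)).2
      linarith
    · rw [← hcst]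
      refine intervalIntegral.integral_mono_on_of_le_Ioo hab.le
        (hpi.sub (hf.intervalIntegrable _ _)) intervalIntegrable_const fun x hx => ?_
      have := (abs_le.1 (h x hx)).1
      linarith
  calc _ ≤ _ := abs_sub_le _ _ _
    _ ≤ _ := add_le_add h1 h2
    _ = _ := by ring

/-- The error of the composite Gauss rule, for an integrand that is close to a polynomial of
degree at most `k + 1` on each interval of the partition. -/
theorem exists_gaussForm_error_le (k : ℕ) : ∃ K : ℝ, 0 ≤ K ∧ ∀ (M : ℕ) (y : ℝ → ℝ)
    (P : Partition M y) (g F φ : ℝ → ℝ), 1 ≤ M → IsBM g → IsBM F → φ ∈ dgSpace k M →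
    (∀ q < P.n, ∃ s : ℝ[X], s.natDegree ≤ k + 1 ∧
      ∀ x ∈ Set.Ioo (P.pt q) (P.pt (q + 1)), ∀ x' ∈ Set.Ioo (P.pt q) (P.pt (q + 1)),
        |g x - s.eval x| ≤ F x') →
    |gaussForm k P g φ - l2inner g φ| ≤ K * l2norm F * l2norm φ := by
  obtain ⟨K, hK, hKle⟩ := exists_abs_le_cellNorm k
  refine ⟨2 * K, by positivity, fun M y P g F φ hM hg hF hφ h => ?_⟩
  have hφm := IsBM.of_mem_dgSpace hM hφ
  have hRm : IsBM (cellNorm M φ) := hφm.cellNorm hM hφ.1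
  have hFR := hF.mul hRm
  have hsum : ∀ f : ℝ → ℝ, IsBM f → ∫ x in (0 : ℝ)..1, f x =
      ∑ q ∈ Finset.range P.n, ∫ x in P.pt q..P.pt (q + 1), f x := by
    intro f hf
    rw [intervalIntegral.sum_integral_adjacent_intervals fun q _ => hf.intervalIntegrable _ _,
      P.pt_zero, P.pt_last]
  rw [l2inner, hsum _ (hg.mul hφm), gaussForm, ← Finset.sum_sub_distrib]
  calc _ ≤ ∑ q ∈ Finset.range P.n, 2 * (K * ∫ x in P.pt q..P.pt (q + 1),
            F x * cellNorm M φ x) := by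
        refine (Finset.abs_sum_le_sum_abs _ _).trans (Finset.sum_le_sum fun q hq => ?_)
        have hq := Finset.mem_range.1 hq
        have hlt := P.pt_lt q hq
        obtain ⟨s, hsd, hs⟩ := h q hq
        obtain ⟨i, hi⟩ := P.mem_cell q hq
        obtain ⟨a, ha⟩ := exists_cell_expansion hM hφ i
        let r : ℝ[X] := ∑ n : Fin (k + 1), C (a n) * (C (M : ℝ) * X - C (i : ℝ)) ^ (n : ℕ)
        have hr : ∀ x ∈ Set.Ioo (P.pt q) (P.pt (q + 1)), φ x = r.eval x := by
          intro x hx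
          rw [ha x (floor_mul_of_mem_cell hM (hi hx))]
          simp [r, eval_finsetSum]
        have hrd : r.natDegree ≤ k := by
          refine natDegree_sum_le_of_forall_le _ _ fun n _ => ?_
          have h1 : (C (M : ℝ) * X - C (i : ℝ)).natDegree ≤ 1 := by compute_degree
          refine (natDegree_C_mul_le _ _).trans (natDegree_pow_le.trans ?_)
          have h2 := n.2
          calc _ ≤ (n : ℕ) * 1 := Nat.mul_le_mul le_rfl h1
            _ ≤ k := by omega
        -- Here (k + 1) + k uses up the exactness of the rule: this is why g may be approximated by
        -- polynomials of degree k + 1.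
        have hdeg : (s * r).natDegree ≤ 2 * k + 1 := natDegree_mul_le.trans (by omega)
        have key : ∀ x' ∈ Set.Ioo (P.pt q) (P.pt (q + 1)),
            |(∑ i, gaussWeight k i / 2 * (P.pt (q + 1) - P.pt q) *
              (g ((P.pt q + P.pt (q + 1)) / 2 + gaussNode k i * ((P.pt (q + 1) - P.pt q) / 2)) *
              φ ((P.pt q + P.pt (q + 1)) / 2 + gaussNode k i * ((P.pt (q + 1) - P.pt q) / 2))))
              - ∫ t in P.pt q..P.pt (q + 1), g t * φ t| ≤
            2 * ((P.pt (q + 1) - P.pt q) * (F x' * (K * cellNorm M φ x'))) := by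
          intro x' hx'
          refine gauss_error_le hlt (hg.mul hφm) hdeg fun x hx => ?_
          rw [eval_mul, ← hr x hx, ← sub_mul, abs_mul]
          have hF0 : 0 ≤ F x' := (abs_nonneg _).trans (hs x hx x' hx')
          refine mul_le_mul (hs x hx x' hx') ?_ (abs_nonneg _) hF0
          rw [cellNorm_congr (x' := x) (by rw [floor_mul_of_mem_cell hM (hi hx),
            floor_mul_of_mem_cell hM (hi hx')])]
          exact hKle M φ hM hφ x
        have hba : 0 < P.pt (q + 1) - P.pt q := sub_pos.2 hlt
        set E := |(∑ i, gaussWeight k i / 2 * (P.pt (q + 1) - P.pt q) *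
              (g ((P.pt q + P.pt (q + 1)) / 2 + gaussNode k i * ((P.pt (q + 1) - P.pt q) / 2)) *
              φ ((P.pt q + P.pt (q + 1)) / 2 + gaussNode k i * ((P.pt (q + 1) - P.pt q) / 2))))
              - ∫ t in P.pt q..P.pt (q + 1), g t * φ t|
        -- The bound `key` holds for every x' of the interval, so it may be averaged over x'. This
        -- turns the sum over the intervals into one integral, ready for Cauchy–Schwarz.
        have hE : ∫ _ in P.pt q..P.pt (q + 1), E / (P.pt (q + 1) - P.pt q) = E := by
          simp; field_simp
        rw [← hE, ← intervalIntegral.integral_const_mul, ← intervalIntegral.integral_const_mul]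
        refine intervalIntegral.integral_mono_on_of_le_Ioo hlt.le intervalIntegrable_const
          (((hFR.const_mul K).const_mul 2).intervalIntegrable _ _) fun x' hx' => ?_
        rw [div_le_iff₀ hba]
        calc _ ≤ _ := key x' hx'
          _ = _ := by ring
    _ = 2 * K * l2inner F (cellNorm M φ) := by
        rw [← Finset.mul_sum, ← Finset.mul_sum, ← hsum _ hFR, l2inner]; ring
    _ ≤ 2 * K * (l2norm F * l2norm (cellNorm M φ)) :=
        mul_le_mul_of_nonneg_left (l2inner_le hF hRm) (by positivity)
    _ = _ := by rw [l2norm_cellNorm hM hφm]; ring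

/-! ### Binomial and Taylor expansions, derivatives of compositions -/

/-- Two steps of the binomial expansion of `t ^ n` at `l`. -/
theorem abs_pow_sub_binomial_le {t l τ R : ℝ} (hR : 1 ≤ R) (ht : |t| ≤ 1) (hl : |l| ≤ R) (n : ℕ) :
    |t ^ n - (l ^ n + n * l ^ (n - 1) * τ)| ≤
      n ^ 2 * R ^ n * (t - l) ^ 2 + n * R ^ n * |t - l - τ| := by
  have hR0 : 0 ≤ R := zero_le_one.trans hR
  have hpow : ∀ m : ℕ, |l ^ m| ≤ R ^ m := fun m => by
    rw [abs_pow]; exact pow_le_pow_left₀ (abs_nonneg _) hl m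
  have h1 : ∀ n : ℕ, |t ^ n - (l ^ n + n * l ^ (n - 1) * (t - l))| ≤ n ^ 2 * R ^ n * (t - l) ^ 2 := by
    intro n
    induction n with
    | zero => simp
    | succ n ih =>
      have e : t ^ (n + 1) - (l ^ (n + 1) + ((n + 1 : ℕ) : ℝ) * l ^ (n + 1 - 1) * (t - l)) =
          t * (t ^ n - (l ^ n + n * l ^ (n - 1) * (t - l))) + n * l ^ (n - 1) * (t - l) ^ 2 := by
        -- At n = 0 the truncated exponent n - 1 is 0, which is harmless since the factor n
        -- vanishes.
        rcases n with _ | n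
        · simp
        · simp only [Nat.add_sub_cancel]; push_cast; ring
      rw [e]
      have h2 : |t * (t ^ n - (l ^ n + n * l ^ (n - 1) * (t - l)))| ≤
          n ^ 2 * R ^ n * (t - l) ^ 2 := by
        rw [abs_mul]
        exact (mul_le_of_le_one_left (abs_nonneg _) ht).trans ih
      have h3 : |n * l ^ (n - 1) * (t - l) ^ 2| ≤ n * R ^ n * (t - l) ^ 2 := by
        rw [abs_mul, abs_mul, Nat.abs_cast, abs_of_nonneg (sq_nonneg (t - l))]
        gcongr
        exact (hpow _).trans (pow_le_pow_right₀ hR (Nat.sub_le _ _))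
      have h4 : (n ^ 2 + n : ℝ) * R ^ n * (t - l) ^ 2 ≤ ((n + 1 : ℕ) : ℝ) ^ 2 * R ^ (n + 1) *
          (t - l) ^ 2 := by
        have : R ^ n ≤ R ^ (n + 1) := pow_le_pow_right₀ hR (Nat.le_succ _)
        gcongr
        push_cast
        nlinarith [(Nat.cast_nonneg n : (0 : ℝ) ≤ n)]
      calc _ ≤ _ := abs_add_le _ _
        _ ≤ _ := add_le_add h2 h3
        _ = (n ^ 2 + n : ℝ) * R ^ n * (t - l) ^ 2 := by ring
        _ ≤ _ := h4
  have e : t ^ n - (l ^ n + n * l ^ (n - 1) * τ) = (t ^ n - (l ^ n + n * l ^ (n - 1) * (t - l)))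
      + n * l ^ (n - 1) * (t - l - τ) := by ring
  rw [e]
  refine (abs_add_le _ _).trans (add_le_add (h1 n) ?_)
  rw [abs_mul, abs_mul, Nat.abs_cast]
  gcongr
  exact (hpow _).trans (pow_le_pow_right₀ hR (Nat.sub_le _ _))


theorem abs_sub_taylor_le {f : ℝ → ℝ} {n : ℕ} (hf : ContDiff ℝ (n + 1 : ℕ) f) {C : ℝ}
    (hC : ∀ x, |iteratedDeriv (n + 1) f x| ≤ C) {a x : ℝ} (hax : a ≤ x) :
    |f x - ∑ i ∈ Finset.range (n + 1), (i.factorial : ℝ)⁻¹ * iteratedDeriv i f a * (x - a) ^ i|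
      ≤ C * (x - a) ^ (n + 1) := by
  -- Taylor's formula is used on [a, x + 1], which is nondegenerate even if x = a, so that
  -- derivatives within it are the true ones.
  have hlt : a < x + 1 := by linarith
  have hU := uniqueDiffOn_Icc hlt
  have hC0 : 0 ≤ C := (abs_nonneg _).trans (hC 0)
  have hw : ∀ i ≤ n + 1, ∀ t ∈ Set.Icc a (x + 1),
      iteratedDerivWithin i f (Set.Icc a (x + 1)) t = iteratedDeriv i f t := fun i hi t ht =>
    iteratedDerivWithin_eq_iteratedDeriv hU
      ((hf.of_le (by exact_mod_cast hi)).contDiffAt) ht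
  have h := taylor_mean_remainder_bound (f := f) (n := n) (C := C) (x := x) hlt.le
    (by exact_mod_cast hf.contDiffOn) ⟨hax, by linarith⟩
    (fun t ht => by rw [hw _ le_rfl t ht]; exact hC t)
  rw [taylor_within_apply, Real.norm_eq_abs] at h
  refine le_trans (le_of_eq ?_) (h.trans (div_le_self ?_ ?_))
  · congr 2
    refine Finset.sum_congr rfl fun i hi => ?_
    rw [hw i (Finset.mem_range.1 hi).le a ⟨le_rfl, hlt.le⟩, smul_eq_mul]; ring
  · exact mul_nonneg hC0 (pow_nonneg (by linarith) _)
  · exact_mod_cast Nat.one_le_iff_ne_zero.2 (Nat.factorial_ne_zero n)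

theorem periodic_iteratedDeriv {f : ℝ → ℝ} (hf : Function.Periodic f 1) (r : ℕ) :
    Function.Periodic (iteratedDeriv r f) 1 := by
  intro x
  have h := congrFun (iteratedDeriv_comp_add_const r f 1) x
  rw [← h]
  congr 1
  exact funext hf

theorem IsBM.iteratedDeriv {f : ℝ → ℝ} {p r : ℕ} (hf : ContDiff ℝ p f)
    (hp : Function.Periodic f 1) (hr : r ≤ p) : IsBM (iteratedDeriv r f) :=
  .of_continuous_periodic (hf.continuous_iteratedDeriv r (by exact_mod_cast hr))
    (periodic_iteratedDeriv hp r)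

theorem abs_le_supNorm {f : ℝ → ℝ} (hf : IsBM f) (x : ℝ) : |f x| ≤ supNorm f := by
  obtain ⟨C, hC⟩ := hf.2
  exact le_ciSup (f := fun x => |f x|) ⟨C, by rintro _ ⟨t, rfl⟩; exact hC t⟩ x

theorem abs_iteratedDeriv_le_derivBound {ψ : ℝ → ℝ} {p r : ℕ} (hψ : ContDiff ℝ p ψ)
    (hp : Function.Periodic ψ 1) (hr : r ≤ p) (x : ℝ) :
    |iteratedDeriv r ψ x| ≤ derivBound p ψ :=
  (abs_le_supNorm (.iteratedDeriv hψ hp hr) x).trans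
    (le_ciSup (f := fun r : Fin (p + 1) => supNorm (iteratedDeriv r ψ))
      (Set.finite_range _).bddAbove ⟨r, Nat.lt_succ_of_le hr⟩)

theorem derivBound_nonneg {ψ : ℝ → ℝ} {p : ℕ} (hψ : ContDiff ℝ p ψ)
    (hp : Function.Periodic ψ 1) : 0 ≤ derivBound p ψ :=
  (abs_nonneg _).trans (abs_iteratedDeriv_le_derivBound hψ hp (Nat.zero_le _) 0)

/-- The Faà di Bruno bound for Fréchet derivatives, which wants D ^ i as the bound at order i; 1 ≤ D
lets the single constant D serve for all orders. -/
theorem abs_iteratedDeriv_comp_le {g f : ℝ → ℝ} {N n : ℕ} (hg : ContDiff ℝ N g)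
    (hf : ContDiff ℝ N f) (hn : n ≤ N) {C D : ℝ} (hD1 : 1 ≤ D)
    (hC : ∀ i ≤ n, ∀ x, |iteratedDeriv i g x| ≤ C)
    (hD : ∀ i, 1 ≤ i → i ≤ n → ∀ x, |iteratedDeriv i f x| ≤ D) (x : ℝ) :
    |iteratedDeriv n (fun x => g (f x)) x| ≤ n.factorial * C * D ^ n := by
  have h := norm_iteratedFDeriv_comp_le hg hf (by exact_mod_cast hn) x (C := C) (D := D)
    (fun i hi => by
      rw [norm_iteratedFDeriv_eq_norm_iteratedDeriv]; exact hC i hi _)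
    (fun i hi hin => by
      rw [norm_iteratedFDeriv_eq_norm_iteratedDeriv]
      exact (hD i hi hin x).trans (le_self_pow₀ hD1 (by omega)))
  rwa [norm_iteratedFDeriv_eq_norm_iteratedDeriv] at h

/-! ### Quadrature error along a characteristic -/

/-- A lift of a circle diffeomorphism with derivative at least `c`, derivatives bounded by `D`,
and derivatives of order at least two bounded by `ε`. -/
structure IsGoodChar (k : ℕ) (c D ε : ℝ) (y : ℝ → ℝ) : Prop where
  contDiff : ContDiff ℝ (2 * k + 2 : ℕ) y
  map_add_one : ∀ x, y (x + 1) = y x + 1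
  le_deriv : ∀ x, c ≤ deriv y x
  bound : ∀ r, 1 ≤ r → r ≤ 2 * k + 2 → ∀ x, |iteratedDeriv r y x| ≤ D
  small : ∀ r, 2 ≤ r → r ≤ 2 * k + 2 → ∀ x, |iteratedDeriv r y x| ≤ ε

theorem IsGoodChar.differentiable {c D ε : ℝ} {y : ℝ → ℝ} (hy : IsGoodChar k c D ε y) :
    Differentiable ℝ y :=
  hy.contDiff.differentiable (by exact_mod_cast (show 2 * k + 2 ≠ 0 by omega))

theorem IsGoodChar.measurable {c D ε : ℝ} {y : ℝ → ℝ} (hy : IsGoodChar k c D ε y) :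
    Measurable y := hy.differentiable.continuous.measurable

theorem Partition.length_le {y : ℝ → ℝ} (P : Partition M y) {q : ℕ} (hq : q < P.n) :
    P.pt (q + 1) - P.pt q ≤ 1 / M := by
  obtain ⟨i, hi⟩ := P.mem_cell q hq
  have := (Set.Ioo_subset_Ioo_iff (P.pt_lt q hq)).1 hi
  have h1 : ((i : ℝ) + 1) / M = i / M + 1 / M := by ring
  linarith [this.1, this.2]

/-- A piecewise polynomial composed with a characteristic is, on each interval of the partition,
close to a polynomial whose degree is larger by only one. -/
theorem exists_comp_approx (k : ℕ) (c D : ℝ) : ∃ K : ℝ, 0 ≤ K ∧ ∀ (ε : ℝ) (y : ℝ → ℝ),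
    0 ≤ ε → ε ≤ D → IsGoodChar k c D ε y → ∀ (M : ℕ) (P : Partition M y) (u : ℝ → ℝ), 1 ≤ M →
    u ∈ dgSpace k M → ∀ q < P.n, ∃ s : ℝ[X], s.natDegree ≤ k + 1 ∧
      ∀ x ∈ Set.Ioo (P.pt q) (P.pt (q + 1)), ∀ x' ∈ Set.Ioo (P.pt q) (P.pt (q + 1)),
        |u (y x) - s.eval x| ≤ K * ε * (1 / (M : ℝ)) ^ 2 * cellNorm M u (y x') := by
  obtain ⟨K, hK, hexp⟩ := exists_cell_expansion_le k
  -- The sign of D is known only once 0 ≤ ε ≤ D is available, hence |D|.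
  refine ⟨(k + 1) * K * (k ^ 2 * (1 + |D|) ^ k * |D| + k * (1 + |D|) ^ k), by positivity, ?_⟩
  intro ε y hε hεD hy M P u hM hu q hq
  have hM' : (0 : ℝ) < M := by exact_mod_cast hM
  have hD : 0 ≤ D := hε.trans hεD
  rw [abs_of_nonneg hD]
  obtain ⟨j, hj⟩ := P.image_mem_cell q hq
  have hfl : ∀ x ∈ Set.Ioo (P.pt q) (P.pt (q + 1)), ⌊(M : ℝ) * y x⌋ = j := fun x hx =>
    floor_mul_of_mem_cell hM (hj ⟨x, hx, rfl⟩)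
  obtain ⟨a, ha, hale⟩ := hexp M u hM hu j
  -- For k = 0 the characteristic is only C², and no third-order remainder is available; but then u
  -- ∘ y is constant on the interval.
  rcases Nat.eq_zero_or_pos k with rfl | hk
  · refine ⟨C (a 0), by simp, fun x hx x' hx' => ?_⟩
    rw [ha _ (hfl x hx)]
    simp
  set p := P.pt q
  have hlen := P.length_le hq
  -- L and Q are the affine part and the quadratic term of the Taylor expansion of t = M y - j at
  -- the left end point p. Keeping only the first power of Q limits the degree to n + 1.
  let L : ℝ[X] := C ((M : ℝ) * y p - j) + C ((M : ℝ) * iteratedDeriv 1 y p) * (X - C p)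
  let Q : ℝ[X] := C ((M : ℝ) * (iteratedDeriv 2 y p / 2)) * (X - C p) ^ 2
  have hLd : L.natDegree ≤ 1 := by simp only [L]; compute_degree
  have hQd : Q.natDegree ≤ 2 := by simp only [Q]; compute_degree
  refine ⟨∑ n : Fin (k + 1), C (a n) * (L ^ (n : ℕ) + C ((n : ℕ) : ℝ) * L ^ ((n : ℕ) - 1) * Q),
    ?_, fun x hx x' hx' => ?_⟩
  · refine natDegree_sum_le_of_forall_le _ _ fun n _ => (natDegree_C_mul_le _ _).trans ?_
    have hn := n.2
    refine natDegree_add_le_of_degree_le ?_ ?_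
    · refine natDegree_pow_le.trans ?_
      calc (n : ℕ) * L.natDegree ≤ n * 1 := Nat.mul_le_mul le_rfl hLd
        _ ≤ k + 1 := by omega
    · rcases Nat.eq_zero_or_pos (n : ℕ) with h0 | hpos
      · simp [h0]
      · refine natDegree_mul_le.trans ?_
        have h1 : (C ((n : ℕ) : ℝ) * L ^ ((n : ℕ) - 1)).natDegree ≤ (n : ℕ) - 1 :=
          (natDegree_C_mul_le _ _).trans (natDegree_pow_le.trans (by
            calc ((n : ℕ) - 1) * L.natDegree ≤ ((n : ℕ) - 1) * 1 := Nat.mul_le_mul le_rfl hLd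
              _ = _ := mul_one _))
        omega
  have hxp : 0 ≤ x - p := by linarith [hx.1]
  have hxM : x - p ≤ 1 / M := by linarith [hx.2]
  set t := (M : ℝ) * y x - j with ht
  have ht0 : |t| ≤ 1 := by
    have h1 := Int.fract_nonneg ((M : ℝ) * y x)
    have h2 := (Int.fract_lt_one ((M : ℝ) * y x)).le
    rw [Int.fract, hfl x hx] at h1 h2
    rw [abs_of_nonneg h1]; exact h2
  have hT1 : |t - L.eval x| ≤ ε * (1 / M) := by
    have h := abs_sub_taylor_le (f := y) (n := 1)
      (hy.contDiff.of_le (by exact_mod_cast (show 2 ≤ 2 * k + 2 by omega)))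
      (fun x => hy.small 2 le_rfl (by omega) x) (show p ≤ x by linarith)
    have e : t - L.eval x = M * (y x - ∑ i ∈ Finset.range (1 + 1),
        (i.factorial : ℝ)⁻¹ * iteratedDeriv i y p * (x - p) ^ i) := by
      simp [ht, L, Finset.sum_range_succ]; ring
    rw [e, abs_mul, abs_of_pos hM']
    calc _ ≤ M * (ε * (x - p) ^ (1 + 1)) := by gcongr
      _ ≤ M * (ε * (1 / M) ^ (1 + 1)) := by gcongr
      _ = _ := by simp only [Nat.reduceAdd]; field_simp
  -- The third-order remainder ε Δx³ loses one power of Δx to the scaling factor M.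
  have hT2 : |t - L.eval x - Q.eval x| ≤ ε * (1 / M) ^ 2 := by
    have h := abs_sub_taylor_le (f := y) (n := 2)
      (hy.contDiff.of_le (by exact_mod_cast (show 3 ≤ 2 * k + 2 by omega)))
      (fun x => hy.small 3 (by omega) (by omega) x) (show p ≤ x by linarith)
    have e : t - L.eval x - Q.eval x = M * (y x - ∑ i ∈ Finset.range (2 + 1),
        (i.factorial : ℝ)⁻¹ * iteratedDeriv i y p * (x - p) ^ i) := by
      simp [ht, L, Q, Finset.sum_range_succ]; ring
    rw [e, abs_mul, abs_of_pos hM']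
    calc _ ≤ M * (ε * (x - p) ^ (2 + 1)) := by gcongr
      _ ≤ M * (ε * (1 / M) ^ (2 + 1)) := by gcongr
      _ = _ := by simp only [Nat.reduceAdd]; field_simp
  have hM1 : 1 / (M : ℝ) ≤ 1 := by
    rw [div_le_one hM']; exact_mod_cast hM
  have hL : |L.eval x| ≤ 1 + D := by
    have h1 : |L.eval x| ≤ |t| + |t - L.eval x| := by
      have h2 := abs_sub t (t - L.eval x)
      rwa [sub_sub_cancel] at h2
    have h3 : ε * (1 / M) ≤ D * 1 := mul_le_mul hεD hM1 (by positivity) hD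
    linarith
  set A := cellNorm M u (y x')
  have hA : 0 ≤ A := cellNorm_nonneg _ _ _
  rw [ha _ (hfl x hx), eval_finsetSum, ← Finset.sum_sub_distrib]
  calc _ ≤ ∑ n : Fin (k + 1), |a n * t ^ (n : ℕ) -
            (C (a n) * (L ^ (n : ℕ) + C ((n : ℕ) : ℝ) * L ^ ((n : ℕ) - 1) * Q)).eval x| :=
          Finset.abs_sum_le_sum_abs _ _
    _ ≤ ∑ _n : Fin (k + 1), K * A * (k ^ 2 * (1 + D) ^ k * (D * ε * (1 / M) ^ 2) +
          k * (1 + D) ^ k * (ε * (1 / M) ^ 2)) := by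
        refine Finset.sum_le_sum fun n _ => ?_
        simp only [eval_mul, eval_add, eval_pow, eval_C]
        rw [← mul_sub, abs_mul]
        have hnk : (n : ℕ) ≤ k := Nat.lt_succ_iff.1 n.2
        have hnk' : ((n : ℕ) : ℝ) ≤ k := by exact_mod_cast hnk
        have hRn : (1 + D) ^ (n : ℕ) ≤ (1 + D) ^ k := pow_le_pow_right₀ (by linarith) hnk
        -- One factor ε is traded for D, so that the bound is linear in ε like the other error term.
        have hsq : (t - L.eval x) ^ 2 ≤ D * ε * (1 / M) ^ 2 := by
          rw [← sq_abs]
          calc _ ≤ (ε * (1 / M)) ^ 2 := by gcongr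
            _ = ε * ε * (1 / M) ^ 2 := by ring
            _ ≤ _ := by gcongr
        refine mul_le_mul (hale n _ (hfl x' hx')) ?_ (abs_nonneg _) (mul_nonneg hK hA)
        refine (abs_pow_sub_binomial_le (by linarith) ht0 hL n).trans ?_
        gcongr
    _ = _ := by simp; ring

/-- The pointwise bound is a multiple of `cellNorm M u ∘ y`; the change of variables y costs a
factor c^(-1/2) in its L² norm. This is estimate (i) with ε in place of √Δt. -/
theorem exists_comp_gaussForm_error_le (k : ℕ) {c : ℝ} (hc : 0 < c) (D : ℝ) :
    ∃ K : ℝ, 0 ≤ K ∧ ∀ (ε : ℝ) (y : ℝ → ℝ), 0 ≤ ε → ε ≤ D → IsGoodChar k c D ε y →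
    ∀ (M : ℕ) (P : Partition M y) (u φ : ℝ → ℝ), 1 ≤ M → u ∈ dgSpace k M → φ ∈ dgSpace k M →
    |gaussForm k P (fun x => u (y x)) φ - l2inner (fun x => u (y x)) φ|
      ≤ K * ε * (1 / (M : ℝ)) ^ 2 * l2norm u * l2norm φ := by
  obtain ⟨K₁, hK₁, happ⟩ := exists_comp_approx k c D
  obtain ⟨K₂, hK₂, herr⟩ := exists_gaussForm_error_le k
  have hc' : 0 < √c := Real.sqrt_pos.2 hc
  refine ⟨K₂ * K₁ / √c, by positivity, fun ε y hε hεD hy M P u φ hM hu hφ => ?_⟩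
  have hum := IsBM.of_mem_dgSpace hM hu
  have hA : IsBM (cellNorm M u) := hum.cellNorm hM hu.1
  have h := herr M y P (fun x => u (y x))
    (fun x => K₁ * ε * (1 / (M : ℝ)) ^ 2 * cellNorm M u (y x)) φ hM
    (hum.comp hy.measurable) ((hA.comp hy.measurable).const_mul _) hφ
    (happ ε y hε hεD hy M P u hM hu)
  have hcv := l2norm_comp_le hc hy.differentiable hy.map_add_one hy.le_deriv hA
    (cellNorm_periodic hM hu.1)
  rw [l2norm_cellNorm hM hum, mul_comm, ← le_div_iff₀ hc'] at hcv
  rw [l2norm_const_mul,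
    abs_of_nonneg (show 0 ≤ K₁ * ε * (1 / (M : ℝ)) ^ 2 by positivity)] at h
  have hφ0 := l2norm_nonneg φ
  calc _ ≤ _ := h
    _ ≤ K₂ * (K₁ * ε * (1 / (M : ℝ)) ^ 2 * (l2norm u / √c)) * l2norm φ := by gcongr
    _ = _ := by ring

/-- The approximating polynomial is 0. This serves for functions that are small but jump, such as a
projection error composed with y. -/
theorem exists_gaussForm_error_le_of_abs_le (k : ℕ) : ∃ K : ℝ, 0 ≤ K ∧ ∀ (M : ℕ) (y : ℝ → ℝ)
    (P : Partition M y) (g φ : ℝ → ℝ) (η : ℝ), 1 ≤ M → IsBM g → φ ∈ dgSpace k M →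
    (∀ x, |g x| ≤ η) → |gaussForm k P g φ - l2inner g φ| ≤ K * η * l2norm φ := by
  obtain ⟨K, hK, herr⟩ := exists_gaussForm_error_le k
  refine ⟨K, hK, fun M y P g φ η hM hg hφ hη => ?_⟩
  have h := herr M y P g (fun _ => η) φ hM hg (IsBM.const η) hφ
    fun q _ => ⟨0, by simp, fun x _ _ _ => by simpa using hη x⟩
  rwa [l2norm_const, abs_of_nonneg ((abs_nonneg _).trans (hη 0))] at h

/-- The composite ψ ∘ y is globally C^(k+1), so its Taylor polynomial of degree k at the left end of
each interval is within a multiple of Δx^(k+1). -/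
theorem exists_smooth_gaussForm_error_le (k : ℕ) (c D : ℝ) (hD : 1 ≤ D) :
    ∃ K : ℝ, 0 ≤ K ∧ ∀ (ε : ℝ) (y : ℝ → ℝ), IsGoodChar k c D ε y →
    ∀ (M : ℕ) (P : Partition M y) (ψ φ : ℝ → ℝ), 1 ≤ M → ContDiff ℝ (k + 1 : ℕ) ψ →
    Function.Periodic ψ 1 → φ ∈ dgSpace k M →
    |gaussForm k P (fun x => ψ (y x)) φ - l2inner (fun x => ψ (y x)) φ|
      ≤ K * derivBound (k + 1) ψ * (1 / (M : ℝ)) ^ (k + 1) * l2norm φ := by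
  obtain ⟨K, hK, herr⟩ := exists_gaussForm_error_le k
  refine ⟨K * ((k + 1).factorial * D ^ (k + 1)), by positivity,
    fun ε y hy M P ψ φ hM hψ hψp hφ => ?_⟩
  have hM' : (0 : ℝ) < M := by exact_mod_cast hM
  have hB := derivBound_nonneg hψ hψp
  have hyk : ContDiff ℝ (k + 1 : ℕ) y :=
    hy.contDiff.of_le (by exact_mod_cast (show k + 1 ≤ 2 * k + 2 by omega))
  have hcomp : ContDiff ℝ (k + 1 : ℕ) (fun x => ψ (y x)) := hψ.comp hyk
  have hder := abs_iteratedDeriv_comp_le hψ hyk le_rfl hD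
    (fun i hi x => abs_iteratedDeriv_le_derivBound hψ hψp hi x)
    (fun i hi hik x => hy.bound i hi (by omega) x)
  set B := ((k + 1).factorial : ℝ) * derivBound (k + 1) ψ * D ^ (k + 1)
  have hB0 : 0 ≤ B := by positivity
  have h := herr M y P (fun x => ψ (y x)) (fun _ => B * (1 / (M : ℝ)) ^ (k + 1)) φ hM
    ((IsBM.of_continuous_periodic hψ.continuous hψp).comp hy.measurable) (IsBM.const _) hφ
    fun q hq => by
      refine ⟨∑ i ∈ Finset.range (k + 1), C ((i.factorial : ℝ)⁻¹ *
        iteratedDeriv i (fun x => ψ (y x)) (P.pt q)) * (X - C (P.pt q)) ^ i, ?_,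
        fun x hx x' _ => ?_⟩
      · refine natDegree_sum_le_of_forall_le _ _ fun i hi => (natDegree_C_mul_le _ _).trans ?_
        rw [natDegree_pow, natDegree_X_sub_C, mul_one]
        exact (Finset.mem_range.1 hi).le
      · have hT := abs_sub_taylor_le hcomp hder hx.1.le
        simp only [eval_finsetSum, eval_mul, eval_C, eval_pow, eval_sub, eval_X]
        have h1 : x - P.pt q ≤ 1 / M := by linarith [P.length_le hq, hx.2]
        have h2 : 0 ≤ x - P.pt q := by linarith [hx.1]
        exact hT.trans (by gcongr)
  rw [l2norm_const, abs_of_nonneg (show 0 ≤ B * (1 / (M : ℝ)) ^ (k + 1) by positivity)] at h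
  exact h.trans (le_of_eq (by ring))

/-- The cellwise Taylor polynomial. -/
theorem exists_mem_dgSpace_abs_sub_le (hM : 1 ≤ M) {ψ : ℝ → ℝ} (hψ : ContDiff ℝ (k + 1 : ℕ) ψ)
    (hp : Function.Periodic ψ 1) : ∃ T ∈ dgSpace k M, ∀ x,
      |T x - ψ x| ≤ derivBound (k + 1) ψ * (1 / (M : ℝ)) ^ (k + 1) := by
  have hM' : (0 : ℝ) < M := by exact_mod_cast hM
  have hB := derivBound_nonneg hψ hp
  let T : ℝ → ℝ := fun x => ∑ i ∈ Finset.range (k + 1), (i.factorial : ℝ)⁻¹ *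
    iteratedDeriv i ψ ((⌊(M : ℝ) * x⌋ : ℝ) / M) * (x - (⌊(M : ℝ) * x⌋ : ℝ) / M) ^ i
  refine ⟨T, ⟨fun x => ?_, fun i _ => ?_⟩, fun x => ?_⟩
  · have h1 : ⌊(M : ℝ) * (x + 1)⌋ = ⌊(M : ℝ) * x⌋ + M := by
      rw [mul_add, mul_one]; exact_mod_cast Int.floor_add_natCast _ _
    have h2 : ((⌊(M : ℝ) * (x + 1)⌋ : ℤ) : ℝ) / M = (⌊(M : ℝ) * x⌋ : ℝ) / M + 1 := by
      rw [h1]; push_cast; field_simp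
    simp only [T, h2, periodic_iteratedDeriv hp _ _, add_sub_add_right_eq_sub]
  · refine ⟨∑ n ∈ Finset.range (k + 1), C ((n.factorial : ℝ)⁻¹ *
        iteratedDeriv n ψ ((i : ℝ) / M)) * (X - C ((i : ℝ) / M)) ^ n, ?_, fun x hx => ?_⟩
    · refine natDegree_sum_le_of_forall_le _ _ fun n hn => (natDegree_C_mul_le _ _).trans ?_
      rw [natDegree_pow, natDegree_X_sub_C, mul_one]
      exact Nat.lt_succ_iff.1 (Finset.mem_range.1 hn)
    · have hfl : ⌊(M : ℝ) * x⌋ = (i : ℤ) := (floor_mul_eq_iff hM).2 (by simpa using hx)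
      simp [T, hfl, eval_finsetSum]
  · have hx := (floor_mul_eq_iff hM (x := x)).1 rfl
    rw [add_div] at hx
    have h1 : x - (⌊(M : ℝ) * x⌋ : ℝ) / M ≤ 1 / M := by linarith [hx.2]
    have h2 : 0 ≤ x - (⌊(M : ℝ) * x⌋ : ℝ) / M := by linarith [hx.1]
    rw [abs_sub_comm]
    refine (abs_sub_taylor_le hψ
      (fun x => abs_iteratedDeriv_le_derivBound hψ hp le_rfl x) hx.1).trans ?_
    gcongr


/-! ### Calculus of derivative bounds -/

/-- `C^N` functions whose derivatives of orders `1, …, N` are bounded by `B`. -/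
def HasDerivsLE (N : ℕ) (B : ℝ) (f : ℝ → ℝ) : Prop :=
  ContDiff ℝ N f ∧ ∀ r, 1 ≤ r → r ≤ N → ∀ x, |iteratedDeriv r f x| ≤ B

namespace HasDerivsLE

variable {N : ℕ} {A B : ℝ} {f g : ℝ → ℝ}

theorem mono (hf : HasDerivsLE N A f) (h : A ≤ B) : HasDerivsLE N B f :=
  ⟨hf.1, fun r h1 hr x => (hf.2 r h1 hr x).trans h⟩

theorem add (hf : HasDerivsLE N A f) (hg : HasDerivsLE N B g) :
    HasDerivsLE N (A + B) (fun x => f x + g x) := by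
  refine ⟨hf.1.add hg.1, fun r h1 hr x => ?_⟩
  have hr' : (r : WithTop ℕ∞) ≤ N := by exact_mod_cast hr
  rw [iteratedDeriv_fun_add (hf.1.of_le hr').contDiffAt (hg.1.of_le hr').contDiffAt]
  exact (abs_add_le _ _).trans (add_le_add (hf.2 r h1 hr x) (hg.2 r h1 hr x))

theorem const_mul (c : ℝ) (hf : HasDerivsLE N A f) :
    HasDerivsLE N (|c| * A) (fun x => c * f x) := by
  refine ⟨contDiff_const.mul hf.1, fun r h1 hr x => ?_⟩
  rw [iteratedDeriv_const_mul_field, abs_mul]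
  exact mul_le_mul_of_nonneg_left (hf.2 r h1 hr x) (abs_nonneg c)

theorem const (N : ℕ) (c : ℝ) : HasDerivsLE N 0 (fun _ => c) := by
  refine ⟨contDiff_const, fun r h1 hr x => ?_⟩
  rw [iteratedDeriv_const, if_neg (by omega), abs_zero]

theorem iteratedDeriv_id_eq_zero {r : ℕ} (hr : 2 ≤ r) (x : ℝ) :
    iteratedDeriv r (fun x : ℝ => x) x = 0 := by
  obtain ⟨n, rfl⟩ := Nat.exists_eq_add_of_le' hr
  rw [iteratedDeriv_succ']
  have : deriv (fun x : ℝ => x) = fun _ => 1 := by simp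
  rw [this, iteratedDeriv_const, if_neg (by omega)]

theorem id (N : ℕ) : HasDerivsLE N 1 (fun x => x) := by
  refine ⟨contDiff_id, fun r h1 hr x => ?_⟩
  rcases Nat.lt_or_ge 1 r with h | h
  · rw [iteratedDeriv_id_eq_zero h]; simp
  · obtain rfl : r = 1 := le_antisymm h h1
    simp [iteratedDeriv_one]

theorem comp (hg : ContDiff ℝ N g) (hgB : ∀ r ≤ N, ∀ x, |iteratedDeriv r g x| ≤ B) (hA : 1 ≤ A)
    (hf : HasDerivsLE N A f) : HasDerivsLE N (N.factorial * B * A ^ N) (fun x => g (f x)) := by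
  refine ⟨hg.comp hf.1, fun r h1 hr x => ?_⟩
  have hB : 0 ≤ B := (abs_nonneg _).trans (hgB 0 (Nat.zero_le _) 0)
  refine (abs_iteratedDeriv_comp_le hg hf.1 hr hA (fun i hi x => hgB i (hi.trans hr) x)
    (fun i hi hir x => hf.2 i hi (hir.trans hr) x) x).trans ?_
  have h2 : ((r.factorial : ℕ) : ℝ) ≤ N.factorial := by exact_mod_cast Nat.factorial_le hr
  gcongr

end HasDerivsLE

/-- The identity contributes 1 to the first derivative and nothing to the higher ones, so the size
of the displacement z controls the curvature of x + z. -/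
theorem isGoodChar_of_hasDerivsLE {k : ℕ} {c D ε : ℝ} {z : ℝ → ℝ} (hp : Function.Periodic z 1)
    (hz : HasDerivsLE (2 * k + 2) ε z) (hD : 1 + ε ≤ D) (hc : ∀ x, c ≤ deriv (fun x => x + z x) x) :
    IsGoodChar k c D ε (fun x => x + z x) where
  contDiff := contDiff_id.add hz.1
  map_add_one x := by rw [hp x]; ring
  le_deriv := hc
  bound r h1 hr x := (((HasDerivsLE.id _).add hz).2 r h1 hr x).trans hD
  small r h2 hr x := by
    have hr' : (r : WithTop ℕ∞) ≤ (2 * k + 2 : ℕ) := by exact_mod_cast hr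
    have hid : ContDiffAt ℝ r (fun x : ℝ => x) x := contDiff_id.contDiffAt
    rw [iteratedDeriv_fun_add hid (hz.1.of_le hr').contDiffAt,
      HasDerivsLE.iteratedDeriv_id_eq_zero h2, zero_add]
    exact hz.2 r (by omega) hr x

/-! ### Derivatives of the characteristics -/

/-- The lower bound on the derivative of Platen's characteristics, `q = 1`. -/
theorem platen_bound_one {B S β s b₁ s₁ s₂ r : ℝ} (hB : 0 ≤ B) (hS : 0 ≤ S) (h : B + 3 * S ≤ 1)
    (hr1 : 1 ≤ r) (hr2 : r ≤ 2) (hβ : |β| ≤ B) (hs : |s| ≤ S) (hb₁ : |b₁| ≤ B) (hs₁ : |s₁| ≤ S)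
    (hs₂ : |s₂| ≤ S) :
    -(B + 3 * S) ≤ 1 / 2 * (b₁ * (1 + β + r * s) + β) + 1 / 4 *
      ((s₁ * (1 + β + s) + s₂ * (1 + β - s) + 2 * s) * r +
        (s₁ * (1 + β + s) - s₂ * (1 + β - s)) * 2) := by
  rw [abs_le] at hβ hs hb₁ hs₁ hs₂
  have hrs : -(2 * S) ≤ r * s := by nlinarith
  -- The expression is affine in b₁, s₁, s₂ with coefficients of known sign; `h1`, `h2`, `h3` move
  -- them to the worst values -B, -S, S. Then `h4` and `h5` do the same for β and s, and the rest
  -- discards terms of good sign.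
  have h1 : 0 ≤ (b₁ + B) * (1 + β + r * s) := mul_nonneg (by linarith) (by linarith)
  have h2 : 0 ≤ (r + 2) * ((s₁ + S) * (1 + β + s)) :=
    mul_nonneg (by linarith) (mul_nonneg (by linarith) (by linarith))
  have h3 : 0 ≤ (2 - r) * ((S - s₂) * (1 + β - s)) :=
    mul_nonneg (by linarith) (mul_nonneg (by linarith) (by linarith))
  have h4 : 0 ≤ (β + B) * (1 / 2 * (1 - B) - S) := mul_nonneg (by linarith) (by linarith)
  have h5 : 0 ≤ r * ((s + S) * (1 - B - S)) :=
    mul_nonneg (by linarith) (mul_nonneg (by linarith) (by linarith))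
  have h6 : 0 ≤ (2 - r) * S := mul_nonneg (by linarith) hS
  have h7 : 0 ≤ r * (B * S) := mul_nonneg (by linarith) (mul_nonneg hB hS)
  have h8 : 0 ≤ r * (S * S) := mul_nonneg (by linarith) (mul_nonneg hS hS)
  have h9 : 0 ≤ B * S := mul_nonneg hB hS
  have h10 : 0 ≤ B * B := mul_nonneg hB hB
  linarith

/-- The case q = 0, where 3q² - 1 = -1. The worst values are now s₁ = S and s₂ = -S, at which s
cancels. -/
theorem platen_bound_zero {B S β s b₁ s₁ s₂ : ℝ} (hB : 0 ≤ B) (hS : 0 ≤ S) (h : B + 3 * S ≤ 1)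
    (hβ : |β| ≤ B) (hs : |s| ≤ S) (hb₁ : |b₁| ≤ B) (hs₁ : |s₁| ≤ S) (hs₂ : |s₂| ≤ S) :
    -(B + 3 * S) ≤ 1 / 2 * (b₁ * (1 + β) + β) -
      1 / 4 * (s₁ * (1 + β + s) - s₂ * (1 + β - s)) := by
  rw [abs_le] at hβ hs hb₁ hs₁ hs₂
  have h1 : 0 ≤ (b₁ + B) * (1 + β) := mul_nonneg (by linarith) (by linarith)
  have h2 : 0 ≤ (S - s₁) * (1 + β + s) := mul_nonneg (by linarith) (by linarith)
  have h3 : 0 ≤ (S + s₂) * (1 + β - s) := mul_nonneg (by linarith) (by linarith)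
  have h4 : 0 ≤ (β + B) * (1 - B - S) := mul_nonneg (by linarith) (by linarith)
  have h9 : 0 ≤ B * S := mul_nonneg hB hS
  have h10 : 0 ≤ B * B := mul_nonneg hB hB
  linarith

variable {b σ : ℝ → ℝ} {h θ : ℝ}

theorem hasDerivAt_eulerChar (hb : Differentiable ℝ b) (hσ : Differentiable ℝ σ) (h p x : ℝ) :
    HasDerivAt (eulerChar b σ h p) (1 + h * deriv b x + p * (√h * deriv σ x)) x := by
  have := ((hasDerivAt_id x).add ((hb x).hasDerivAt.mul_const h)).add
    (((hσ x).hasDerivAt.const_mul p).mul_const (√h))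
  exact (show HasDerivAt (eulerChar b σ h p) _ x from this).congr_deriv (by ring)

theorem hasDerivAt_platenChar (hb : Differentiable ℝ b) (hσ : Differentiable ℝ σ) (h q x : ℝ) :
    HasDerivAt (platenChar b σ h q)
      (1 + (1 / 2 * (h * deriv b (eulerChar b σ h (√3 * q) x) *
            (1 + h * deriv b x + √3 * q * (√h * deriv σ x)) + h * deriv b x) + 1 / 4 *
        ((√h * deriv σ (eulerChar b σ h 1 x) * (1 + h * deriv b x + √h * deriv σ x) +
          √h * deriv σ (eulerChar b σ h (-1) x) * (1 + h * deriv b x - √h * deriv σ x) +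
          2 * (√h * deriv σ x)) * √3 * q +
        (√h * deriv σ (eulerChar b σ h 1 x) * (1 + h * deriv b x + √h * deriv σ x) -
          √h * deriv σ (eulerChar b σ h (-1) x) * (1 + h * deriv b x - √h * deriv σ x)) *
            (3 * q ^ 2 - 1)))) x := by
  have hbγ := (hb (eulerChar b σ h (√3 * q) x)).hasDerivAt.comp x
    (hasDerivAt_eulerChar hb hσ h (√3 * q) x)
  have hσ1 := (hσ (eulerChar b σ h 1 x)).hasDerivAt.comp x (hasDerivAt_eulerChar hb hσ h 1 x)
  have hσ2 := (hσ (eulerChar b σ h (-1) x)).hasDerivAt.comp x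
    (hasDerivAt_eulerChar hb hσ h (-1) x)
  have := ((hasDerivAt_id x).add (((hbγ.add (hb x).hasDerivAt).const_mul (1 / 2)).mul_const h)).add
    (((((((hσ1.add hσ2).add ((hσ x).hasDerivAt.const_mul 2)).mul_const (√3)).mul_const q)).add
      ((hσ1.sub hσ2).mul_const (3 * q ^ 2 - 1))).const_mul (1 / 4) |>.mul_const (√h))
  exact (show HasDerivAt (platenChar b σ h q) _ x from this).congr_deriv (by ring)

/-! ### Characteristics uniformly in the admissible time steps -/

/-- Regularity of the coefficients of the equation. -/
structure IsCoeff (N : ℕ) (f : ℝ → ℝ) : Prop where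
  contDiff : ContDiff ℝ N f
  periodic : Function.Periodic f 1
  one_le : 1 ≤ N

namespace IsCoeff

variable {N : ℕ} {f : ℝ → ℝ}

theorem differentiable (hf : IsCoeff N f) : Differentiable ℝ f :=
  hf.contDiff.differentiable (by exact_mod_cast (Nat.one_le_iff_ne_zero.1 hf.one_le))

theorem isBM_deriv (hf : IsCoeff N f) : IsBM (deriv f) := by
  rw [← iteratedDeriv_one]
  exact .iteratedDeriv hf.contDiff hf.periodic hf.one_le

theorem eq_const_or (hf : IsCoeff N f) : (∃ c, f = fun _ => c) ∨ ∃ x, deriv f x ≠ 0 := by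
  by_contra! hc
  exact hc.1 (f 0) (funext fun x => is_const_of_deriv_eq_zero hf.differentiable hc.2 x 0)

end IsCoeff

variable {N : ℕ}

theorem supNorm_nonneg (f : ℝ → ℝ) : 0 ≤ supNorm f := Real.iSup_nonneg fun _ => abs_nonneg _

theorem smallStep_one_abs_le (hb : IsCoeff N b) (hσ : IsCoeff N σ)
    (hs : Scheme.one.SmallStep b σ h θ) (x : ℝ) :
    |h * deriv b x + √h * deriv σ x| ≤ θ ∧ |h * deriv b x - √h * deriv σ x| ≤ θ := by
  have h1 := hb.isBM_deriv.const_mul h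
  have h2 := hσ.isBM_deriv.const_mul (√h)
  exact ⟨(abs_le_supNorm (h1.add h2) x).trans hs.1, (abs_le_supNorm (h1.sub h2) x).trans hs.2⟩

/-- For SLDG-1 the two terms are half the sum and half the difference of the two controlled
quantities. -/
theorem smallStep_abs_le {s : Scheme} (hb : IsCoeff N b) (hσ : IsCoeff N σ) (hh : 0 < h)
    (hs : s.SmallStep b σ h θ) (x : ℝ) :
    |h * deriv b x| ≤ θ ∧ |√h * deriv σ x| ≤ θ := by
  cases s with
  | one =>
    obtain ⟨h1, h2⟩ := smallStep_one_abs_le hb hσ hs x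
    rw [abs_le] at h1 h2
    constructor <;> rw [abs_le] <;> constructor <;> linarith
  | two =>
    have h1 := mul_le_mul_of_nonneg_left (abs_le_supNorm hb.isBM_deriv x) hh.le
    have h2 := mul_le_mul_of_nonneg_left (abs_le_supNorm hσ.isBM_deriv x) (Real.sqrt_nonneg h)
    have h3 := mul_nonneg hh.le (supNorm_nonneg (deriv b))
    have h4 := mul_nonneg (Real.sqrt_nonneg h) (supNorm_nonneg (deriv σ))
    simp only [Scheme.SmallStep] at hs
    rw [abs_mul, abs_mul, abs_of_pos hh, abs_of_nonneg (Real.sqrt_nonneg h)]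
    constructor <;> linarith

theorem le_deriv_char (s : Scheme) (hb : IsCoeff N b) (hσ : IsCoeff N σ) (hh : 0 < h) (hθ : θ < 1)
    (hs : s.SmallStep b σ h θ) {q : ℤ} (hq : q ∈ s.nodes) (x : ℝ) :
    1 - θ ≤ deriv (s.char b σ h q) x := by
  cases s with
  | one =>
    obtain ⟨h1, h2⟩ := smallStep_one_abs_le hb hσ hs x
    rw [Scheme.char, (hasDerivAt_eulerChar hb.differentiable hσ.differentiable h q x).deriv]
    rw [abs_le] at h1 h2
    simp only [Scheme.nodes, Finset.mem_insert, Finset.mem_singleton] at hq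
    rcases hq with rfl | rfl <;> push_cast <;> linarith
  | two =>
    rw [Scheme.char, (hasDerivAt_platenChar hb.differentiable hσ.differentiable h q x).deriv]
    have hB : ∀ t, |h * deriv b t| ≤ h * supNorm (deriv b) := fun t => by
      rw [abs_mul, abs_of_pos hh]
      exact mul_le_mul_of_nonneg_left (abs_le_supNorm hb.isBM_deriv t) hh.le
    have hS : ∀ t, |√h * deriv σ t| ≤ √h * supNorm (deriv σ) := fun t => by
      rw [abs_mul, abs_of_nonneg (Real.sqrt_nonneg h)]
      exact mul_le_mul_of_nonneg_left (abs_le_supNorm hσ.isBM_deriv t) (Real.sqrt_nonneg h)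
    have hB0 := mul_nonneg hh.le (supNorm_nonneg (deriv b))
    have hS0 := mul_nonneg (Real.sqrt_nonneg h) (supNorm_nonneg (deriv σ))
    simp only [Scheme.SmallStep, mul_assoc] at hs
    rw [← mul_assoc, mul_comm 3, mul_assoc, mul_left_comm (√h)] at hs
    have hBS := hs.trans hθ.le
    have hr1 : 1 ≤ √3 := Real.one_le_sqrt.2 (by norm_num)
    have hr2 : √3 ≤ 2 := Real.sqrt_le_iff.2 (by norm_num)
    simp only [Scheme.nodes, Finset.mem_insert, Finset.mem_singleton] at hq
    rcases hq with rfl | rfl | rfl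
    -- The case q = -1 is q = 1 with σ replaced by -σ, which also exchanges the two Euler points.
    · have := platen_bound_one (s := -(√h * deriv σ x))
        (s₁ := -(√h * deriv σ (eulerChar b σ h (-1) x)))
        (s₂ := -(√h * deriv σ (eulerChar b σ h 1 x))) hB0 hS0 hBS hr1 hr2 (hB x)
        (by rw [abs_neg]; exact hS _) (hB (eulerChar b σ h (√3 * (-1 : ℤ)) x))
        (by rw [abs_neg]; exact hS _) (by rw [abs_neg]; exact hS _)
      push_cast at this ⊢
      nlinarith
    · have := platen_bound_zero hB0 hS0 hBS (hB x) (hS x)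
        (hB (eulerChar b σ h (√3 * (0 : ℤ)) x)) (hS (eulerChar b σ h 1 x))
        (hS (eulerChar b σ h (-1) x))
      push_cast at this ⊢
      nlinarith
    · have := platen_bound_one hB0 hS0 hBS hr1 hr2 (hB x) (hS x)
        (hB (eulerChar b σ h (√3 * (1 : ℤ)) x)) (hS (eulerChar b σ h 1 x))
        (hS (eulerChar b σ h (-1) x))
      push_cast at this ⊢
      nlinarith

/-- A point where b' or σ' does not vanish bounds h. A bound on h is needed because the derivative
bounds of the characteristics grow with h. -/
theorem smallStep_bounded_or_const (s : Scheme) (hb : IsCoeff N b) (hσ : IsCoeff N σ)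
    (hθ : θ < 1) : (∃ H, 0 ≤ H ∧ ∀ h, 0 < h → s.SmallStep b σ h θ → h ≤ H) ∨
      ((∃ c, b = fun _ => c) ∧ ∃ c, σ = fun _ => c) := by
  rcases hb.eq_const_or with hbc | ⟨x, hx⟩
  · rcases hσ.eq_const_or with hσc | ⟨x, hx⟩
    · exact Or.inr ⟨hbc, hσc⟩
    · refine Or.inl ⟨(1 / |deriv σ x|) ^ 2, by positivity, fun h hh hs => ?_⟩
      have h1 := (smallStep_abs_le hb hσ hh hs x).2.trans hθ.le
      rw [abs_mul, abs_of_nonneg (Real.sqrt_nonneg h), ← le_div_iff₀ (abs_pos.2 hx)] at h1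
      calc h = √h ^ 2 := (Real.sq_sqrt hh.le).symm
        _ ≤ _ := pow_le_pow_left₀ (Real.sqrt_nonneg h) h1 2
  · refine Or.inl ⟨1 / |deriv b x|, by positivity, fun h hh hs => ?_⟩
    have h1 := (smallStep_abs_le hb hσ hh hs x).1.trans hθ.le
    rwa [abs_mul, abs_of_pos hh, ← le_div_iff₀ (abs_pos.2 hx)] at h1

/-- The displacement `y^q_h(x) - x` of a characteristic. -/
noncomputable def displacement (s : Scheme) (b σ : ℝ → ℝ) (h : ℝ) (q : ℤ) (x : ℝ) : ℝ :=
  s.char b σ h q x - x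

theorem eulerChar_add_one (hb : Function.Periodic b 1) (hσ : Function.Periodic σ 1) (h p x : ℝ) :
    eulerChar b σ h p (x + 1) = eulerChar b σ h p x + 1 := by
  simp only [eulerChar, hb x, hσ x]; ring

theorem displacement_periodic (s : Scheme) (hb : Function.Periodic b 1)
    (hσ : Function.Periodic σ 1) (h : ℝ) (q : ℤ) :
    Function.Periodic (displacement s b σ h q) 1 := by
  intro x
  cases s with
  | one => simp only [displacement, Scheme.char, eulerChar_add_one hb hσ]; ring
  | two =>
    simp only [displacement, Scheme.char, platenChar, eulerChar_add_one hb hσ, hb _, hσ _]; ring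

theorem node_eq {s : Scheme} {q : ℤ} (hq : q ∈ s.nodes) : q = -1 ∨ q = 0 ∨ q = 1 := by
  cases s <;> simp [Scheme.nodes] at hq <;> omega

theorem exists_hasDerivsLE_displacement (hb : IsCoeff N b) (hσ : IsCoeff N σ) (s : Scheme)
    {H : ℝ} (hH : 0 ≤ H) : ∃ E, 0 ≤ E ∧ ∀ h, 0 < h → h ≤ H → ∀ q ∈ s.nodes,
      HasDerivsLE N (h * E + 3 * (√h * E)) (displacement s b σ h q) := by
  set B := derivBound N b + derivBound N σ with hBdef
  have hb0 := derivBound_nonneg hb.contDiff hb.periodic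
  have hσ0 := derivBound_nonneg hσ.contDiff hσ.periodic
  have hbB : ∀ r ≤ N, ∀ x, |iteratedDeriv r b x| ≤ B := fun r hr x =>
    (abs_iteratedDeriv_le_derivBound hb.contDiff hb.periodic hr x).trans (by linarith)
  have hσB : ∀ r ≤ N, ∀ x, |iteratedDeriv r σ x| ≤ B := fun r hr x =>
    (abs_iteratedDeriv_le_derivBound hσ.contDiff hσ.periodic hr x).trans (by linarith)
  have hB : 0 ≤ B := by positivity
  -- G bounds the derivatives of the Euler characteristics with parameter |p| ≤ 2, which covers ±1
  -- and √3 q.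
  set G := 1 + H * B + 2 * √H * B with hG
  have hG1 : 1 ≤ G := by
    have : 0 ≤ H * B + 2 * √H * B := by positivity
    linarith
  set E := B + N.factorial * B * G ^ N with hE
  have hG0 : 0 ≤ G := zero_le_one.trans hG1
  have hBE : B ≤ E := by
    have : 0 ≤ N.factorial * B * G ^ N := by positivity
    linarith
  have hbE : HasDerivsLE N E b := ⟨hb.contDiff, fun r _ hr x => (hbB r hr x).trans hBE⟩
  have hσE : HasDerivsLE N E σ := ⟨hσ.contDiff, fun r _ hr x => (hσB r hr x).trans hBE⟩
  have hE0 : 0 ≤ E := hB.trans hBE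
  refine ⟨E, hE0, fun h hh hhH q hq => ?_⟩
  have hsq : √h ≤ √H := Real.sqrt_le_sqrt hhH
  have hq' := node_eq hq
  have hqa : |(q : ℝ)| ≤ 1 := by rcases hq' with rfl | rfl | rfl <;> simp
  have hγ : ∀ p : ℝ, |p| ≤ 2 → HasDerivsLE N G (eulerChar b σ h p) := by
    intro p hp
    have h1 := ((HasDerivsLE.id N).add (HasDerivsLE.const_mul h
      ⟨hb.contDiff, fun r _ hr x => hbB r hr x⟩)).add
      (HasDerivsLE.const_mul (p * √h) ⟨hσ.contDiff, fun r _ hr x => hσB r hr x⟩)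
    have e : eulerChar b σ h p = fun x => x + h * b x + p * √h * σ x := by
      funext x; simp only [eulerChar]; ring
    rw [e]
    refine h1.mono ?_
    rw [abs_mul, abs_of_pos hh, abs_of_nonneg (Real.sqrt_nonneg h), hG]
    gcongr
  have hbγ : ∀ p : ℝ, |p| ≤ 2 → HasDerivsLE N E (fun x => b (eulerChar b σ h p x)) := fun p hp =>
    (HasDerivsLE.comp hb.contDiff hbB hG1 (hγ p hp)).mono (by linarith)
  have hσγ : ∀ p : ℝ, |p| ≤ 2 → HasDerivsLE N E (fun x => σ (eulerChar b σ h p x)) := fun p hp =>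
    (HasDerivsLE.comp hσ.contDiff hσB hG1 (hγ p hp)).mono (by linarith)
  have hsE : 0 ≤ √h * E := by positivity
  cases s with
  | one =>
    have h1 := (hbE.const_mul h).add (hσE.const_mul (q * √h))
    have e : displacement .one b σ h q = fun x => h * b x + q * √h * σ x := by
      funext x; simp only [displacement, Scheme.char, eulerChar]; ring
    rw [e]
    refine h1.mono ?_
    rw [abs_mul, abs_of_pos hh, abs_of_nonneg (Real.sqrt_nonneg h), mul_assoc]
    have := mul_le_mul_of_nonneg_right hqa hsE
    linarith
  | two =>
    have hr2 : √3 ≤ 2 := Real.sqrt_le_iff.2 (by norm_num)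
    have hr0 : 0 ≤ √3 := Real.sqrt_nonneg 3
    have hp : |√3 * (q : ℝ)| ≤ 2 := by
      rw [abs_mul, abs_of_nonneg hr0]
      calc _ ≤ 2 * 1 := mul_le_mul hr2 hqa (abs_nonneg _) zero_le_two
        _ = 2 := by norm_num
    have h1 := ((hbγ _ hp).add hbE).const_mul (h / 2)
    have h2 := ((hσγ 1 (by norm_num)).add (hσγ (-1) (by norm_num))).add (hσE.const_mul 2)
    have h3 := (hσγ 1 (by norm_num)).add ((hσγ (-1) (by norm_num)).const_mul (-1))
    have h4 := (h1.add (h2.const_mul (√h / 4 * (√3 * q)))).add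
      (h3.const_mul (√h / 4 * (3 * q ^ 2 - 1)))
    have e : displacement .two b σ h q = fun x =>
        h / 2 * (b (eulerChar b σ h (√3 * q) x) + b x) + √h / 4 * (√3 * q) *
          (σ (eulerChar b σ h 1 x) + σ (eulerChar b σ h (-1) x) + 2 * σ x) +
        √h / 4 * (3 * q ^ 2 - 1) *
          (σ (eulerChar b σ h 1 x) + -1 * σ (eulerChar b σ h (-1) x)) := by
      funext x; simp only [displacement, Scheme.char, platenChar]; ring
    rw [e]
    refine h4.mono ?_
    have hq2 : |3 * (q : ℝ) ^ 2 - 1| ≤ 2 := by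
      rcases hq' with rfl | rfl | rfl <;> norm_num [abs_le]
    rw [abs_mul (√h / 4), abs_mul (√h / 4), abs_of_pos (show 0 < h / 2 by positivity),
      abs_of_nonneg (show 0 ≤ √h / 4 by positivity)]
    have h5 := mul_le_mul_of_nonneg_right hp hsE
    have h6 := mul_le_mul_of_nonneg_right hq2 hsE
    simp only [abs_neg, abs_one, abs_two]
    linarith

/-- The characteristics of the schemes are lifts of circle diffeomorphisms, uniformly in the
admissible time steps. -/
theorem exists_isGoodChar (s : Scheme) {k : ℕ} (hb : IsCoeff (2 * k + 2) b)
    (hσ : IsCoeff (2 * k + 2) σ) (hθ : θ < 1) :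
    ∃ D : ℝ, 1 ≤ D ∧ ∀ h, 0 < h → s.SmallStep b σ h θ → ∃ ε, 0 ≤ ε ∧ ε ≤ D ∧ ε ≤ D * √h ∧
      ∀ q ∈ s.nodes, IsGoodChar k (1 - θ) D ε (s.char b σ h q) := by
  have hchar : ∀ h q, s.char b σ h q = fun x => x + displacement s b σ h q x := fun h q => by
    funext x; simp [displacement]
  have hlow : ∀ h, 0 < h → s.SmallStep b σ h θ → ∀ q ∈ s.nodes, ∀ x,
      1 - θ ≤ deriv (fun x => x + displacement s b σ h q x) x := fun h hh hs q hq x => by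
    rw [← hchar]; exact le_deriv_char s hb hσ hh hθ hs hq x
  rcases smallStep_bounded_or_const s hb hσ hθ with ⟨H, hH, hle⟩ | ⟨⟨c, hc⟩, d, hd⟩
  · obtain ⟨E, hE, hdis⟩ := exists_hasDerivsLE_displacement hb hσ s hH
    have hp1 : 0 ≤ H * E + 3 * (√H * E) := by positivity
    have hp2 : 0 ≤ (√H + 3) * E := by positivity
    -- The first two summands give 1 + ε ≤ D; the last gives ε ≤ D √h, by h ≤ √H √h.
    refine ⟨1 + (H * E + 3 * (√H * E)) + (√H + 3) * E, by linarith, fun h hh hs => ?_⟩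
    have hhH := hle h hh hs
    have hsq : √h ≤ √H := Real.sqrt_le_sqrt hhH
    have h1 : h * E + 3 * (√h * E) ≤ H * E + 3 * (√H * E) := by gcongr
    have h2 : h * E + 3 * (√h * E) ≤ (√H + 3) * E * √h := by
      have h3 : h ≤ √H * √h := by
        calc h = √h * √h := (Real.mul_self_sqrt hh.le).symm
          _ ≤ _ := by gcongr
      have := mul_le_mul_of_nonneg_right h3 hE
      linarith
    have h4 : 0 ≤ (1 + (H * E + 3 * (√H * E))) * √h := by positivity
    refine ⟨h * E + 3 * (√h * E), by positivity, by linarith, by linarith, fun q hq => ?_⟩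
    rw [hchar]
    exact isGoodChar_of_hasDerivsLE (displacement_periodic s hb.periodic hσ.periodic h q)
      (hdis h hh hhH q hq) (by linarith) (hlow h hh hs q hq)
  -- For constant b and σ the characteristics are translations, so ε = 0 works for arbitrarily large
  -- steps.
  · refine ⟨1, le_rfl, fun h hh hs => ⟨0, le_rfl, zero_le_one, by positivity, fun q hq => ?_⟩⟩
    rw [hchar]
    refine isGoodChar_of_hasDerivsLE (displacement_periodic s hb.periodic hσ.periodic h q)
      ?_ (by norm_num) (hlow h hh hs q hq)
    obtain ⟨e, he⟩ : ∃ e, displacement s b σ h q = fun _ => e := by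
      refine ⟨displacement s b σ h q 0, funext fun x => ?_⟩
      subst hc hd
      cases s <;> simp [displacement, Scheme.char, platenChar, eulerChar] <;> ring
    rw [he]
    exact HasDerivsLE.const _ e


/-! ### Existence of partitions -/

/-- A finite subset of `[0, 1]` that contains the end points, as a subdivision. -/
theorem exists_subdivision {S : Set ℝ} (hS : S.Finite) (h01 : S ⊆ Set.Icc 0 1) (h0 : (0 : ℝ) ∈ S)
    (h1 : (1 : ℝ) ∈ S) : ∃ (n : ℕ) (pt : ℕ → ℝ), pt 0 = 0 ∧ pt n = 1 ∧
      ∀ q < n, pt q < pt (q + 1) ∧ pt q ∈ S ∧ pt (q + 1) ∈ S ∧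
        ∀ x ∈ S, x ∉ Set.Ioo (pt q) (pt (q + 1)) := by
  obtain ⟨F, rfl⟩ := hS.exists_finset_coe
  simp only [Finset.mem_coe] at h0 h1 ⊢
  have hF : F.Nonempty := ⟨0, h0⟩
  have hpos : 0 < F.card := hF.card_pos
  let e := F.orderEmbOfFin rfl
  let pt : ℕ → ℝ := fun q => if hq : q < F.card then e ⟨q, hq⟩ else 0
  have hpt : ∀ q (hq : q < F.card), pt q = e ⟨q, hq⟩ := fun q hq => dif_pos hq
  have hmem : ∀ q < F.card, pt q ∈ F := fun q hq => by
    rw [hpt q hq]; exact F.orderEmbOfFin_mem rfl _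
  refine ⟨F.card - 1, pt, ?_, ?_, fun q hq => ⟨?_, hmem q (by omega), hmem _ (by omega), ?_⟩⟩
  · rw [hpt 0 hpos]
    refine (F.orderEmbOfFin_zero rfl hpos).trans (le_antisymm (F.min'_le 0 h0) ?_)
    exact (h01 (F.min'_mem hF)).1
  · rw [hpt _ (by omega)]
    refine (F.orderEmbOfFin_last rfl hpos).trans (le_antisymm ?_ (F.le_max' 1 h1))
    exact (h01 (F.max'_mem hF)).2
  · rw [hpt q (by omega), hpt (q + 1) (by omega)]
    exact e.strictMono (by simp [Fin.lt_def])
  · intro x hx hxI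
    obtain ⟨i, hi⟩ : x ∈ Set.range e := by rw [F.range_orderEmbOfFin rfl]; exact hx
    rw [hpt q (by omega), hpt (q + 1) (by omega), ← hi, Set.mem_Ioo, e.lt_iff_lt, e.lt_iff_lt,
      Fin.lt_def, Fin.lt_def] at hxI
    have := hxI.1
    have := hxI.2
    simp only at *
    omega

theorem finite_grid_preimage (M : ℕ) (hM : 1 ≤ M) {y : ℝ → ℝ} (hy : StrictMono y) :
    {x | x ∈ Set.Icc (0 : ℝ) 1 ∧ ∃ j : ℤ, (M : ℝ) * y x = j}.Finite := by
  have hM' : (0 : ℝ) < M := by exact_mod_cast hM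
  refine Set.Finite.of_finite_image (f := fun x => ⌊(M : ℝ) * y x⌋)
    ((Set.finite_Icc ⌊(M : ℝ) * y 0⌋ ⌊(M : ℝ) * y 1⌋).subset ?_) ?_
  · rintro _ ⟨x, ⟨hx, -⟩, rfl⟩
    exact ⟨Int.floor_le_floor (mul_le_mul_of_nonneg_left (hy.monotone hx.1) hM'.le),
      Int.floor_le_floor (mul_le_mul_of_nonneg_left (hy.monotone hx.2) hM'.le)⟩
  · rintro x ⟨-, j, hj⟩ x' ⟨-, j', hj'⟩ hxx
    simp only [hj, hj', Int.floor_intCast] at hxx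
    refine hy.injective (mul_left_cancel₀ hM'.ne' ?_)
    rw [hj, hj', hxx]

theorem nonempty_partition (hM : 1 ≤ M) {y : ℝ → ℝ} (hy : StrictMono y) (hc : Continuous y) :
    Nonempty (Partition M y) := by
  have hM' : (0 : ℝ) < M := by exact_mod_cast hM
  -- Cut at the grid points and at their preimages under y. Grid points are preimages under the
  -- identity, so `key` yields both cell conditions.
  let S : Set ℝ := {x | x ∈ Set.Icc (0 : ℝ) 1 ∧ ∃ j : ℤ, (M : ℝ) * id x = j} ∪
    {x | x ∈ Set.Icc (0 : ℝ) 1 ∧ ∃ j : ℤ, (M : ℝ) * y x = j}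
  have hS : S.Finite := (finite_grid_preimage M hM strictMono_id).union
    (finite_grid_preimage M hM hy)
  have h01 : S ⊆ Set.Icc 0 1 := by
    rintro x (hx | hx) <;> exact hx.1
  have h0 : (0 : ℝ) ∈ S := Or.inl ⟨by simp, 0, by simp⟩
  have h1 : (1 : ℝ) ∈ S := Or.inl ⟨by simp, M, by simp⟩
  obtain ⟨n, pt, hpt0, hptn, hpt⟩ := exists_subdivision hS h01 h0 h1
  have key : ∀ (f : ℝ → ℝ), StrictMono f → Continuous f →
      (∀ x ∈ Set.Icc (0 : ℝ) 1, (∃ j : ℤ, (M : ℝ) * f x = j) → x ∈ S) → ∀ q < n,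
      ∃ j : ℤ, f '' Set.Ioo (pt q) (pt (q + 1)) ⊆ cell M j := by
    intro f hf hfc hfS q hq
    obtain ⟨hlt, hS0, hS1, hno⟩ := hpt q hq
    refine ⟨⌊(M : ℝ) * f (pt q)⌋, ?_⟩
    rintro _ ⟨x, hx, rfl⟩
    refine ⟨?_, ?_⟩
    · rw [div_lt_iff₀ hM', mul_comm (f x)]
      exact (Int.floor_le _).trans_lt (mul_lt_mul_of_pos_left (hf hx.1) hM')
    · by_contra! hle
      have hl : f (pt q) < ((⌊(M : ℝ) * f (pt q)⌋ : ℝ) + 1) / M := by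
        rw [lt_div_iff₀ hM', mul_comm]; exact Int.lt_floor_add_one _
      -- Leaving the cell would force f through its right end point inside the interval, but every
      -- such crossing is a subdivision point.
      obtain ⟨t, ht, hft⟩ := intermediate_value_Ioc hx.1.le hfc.continuousOn ⟨hl, hle⟩
      have htI : t ∈ Set.Ioo (pt q) (pt (q + 1)) := ⟨ht.1, ht.2.trans_lt hx.2⟩
      refine hno t (hfS t ⟨(h01 hS0).1.trans htI.1.le, htI.2.le.trans (h01 hS1).2⟩
        ⟨⌊(M : ℝ) * f (pt q)⌋ + 1, ?_⟩) htI
      rw [hft, mul_div_cancel₀ _ hM'.ne']; push_cast; rfl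
  exact ⟨⟨n, pt, hpt0, hptn, fun q hq => (hpt q hq).1,
    fun q hq => by
      simpa using key id strictMono_id continuous_id (fun x hx h => Or.inl ⟨hx, h⟩) q hq,
    key y hy hc fun x hx h => Or.inr ⟨hx, h⟩⟩⟩

/-! ### V_k as a Euclidean space, and the projection -/

/-- Sampling at k + 1 equispaced points of each cell is injective on V_k, since a polynomial of
degree at most k with k + 1 zeros vanishes. -/
theorem finiteDimensional_dgSpace (k : ℕ) (hM : 1 ≤ M) : FiniteDimensional ℝ (dgSpace k M) := by
  have hM' : (0 : ℝ) < M := by exact_mod_cast hM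
  let Φ : dgSpace k M →ₗ[ℝ] (Fin M × Fin (k + 1) → ℝ) :=
    { toFun := fun u ia => (u : ℝ → ℝ) (((ia.1 : ℕ) + ((ia.2 : ℕ) : ℝ) / (k + 1)) / M)
      map_add' := fun u v => rfl
      map_smul' := fun c u => rfl }
  refine FiniteDimensional.of_injective Φ ((injective_iff_map_eq_zero Φ).2 fun u hu => ?_)
  refine Subtype.ext (funext fun x => ?_)
  have h1 : (u : ℝ → ℝ) x = (u : ℝ → ℝ) (Int.fract x) := by
    rw [Int.fract]
    simpa using (u.2.1.sub_int_mul_eq ⌊x⌋ (x := x)).symm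
  obtain ⟨i, hi⟩ := Int.eq_ofNat_of_zero_le (Int.floor_nonneg.2
    (mul_nonneg hM'.le (Int.fract_nonneg x)))
  have hiM : i < M := by
    have : ⌊(M : ℝ) * Int.fract x⌋ < (M : ℤ) := by
      rw [Int.floor_lt]
      have := mul_lt_mul_of_pos_left (Int.fract_lt_one x) hM'
      push_cast; linarith
    omega
  have hmem := (floor_mul_eq_iff hM).1 hi
  obtain ⟨p, hpd, hp⟩ := u.2.2 i hiM
  have hp0 : p = 0 := by
    refine eq_zero_of_natDegree_lt_card_of_eval_eq_zero p
      (f := fun a : Fin (k + 1) => ((i : ℝ) + ((a : ℕ) : ℝ) / (k + 1)) / M) ?_ (fun a => ?_)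
      (by simpa using Nat.lt_succ_of_le hpd)
    · intro a a' haa
      simp only at haa
      have hk : ((k : ℝ) + 1) ≠ 0 := by positivity
      field_simp at haa
      exact Fin.ext (by exact_mod_cast (add_left_cancel haa))
    · rw [← hp]
      · exact congrFun hu (⟨i, hiM⟩, a)
      · have ha : ((a : ℕ) : ℝ) < k + 1 := by exact_mod_cast a.2
        have h2 : ((a : ℕ) : ℝ) / (k + 1) < 1 := by rw [div_lt_one (by positivity)]; exact ha
        have h3 : 0 ≤ ((a : ℕ) : ℝ) / (k + 1) := by positivity
        constructor
        · gcongr; linarith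
        · gcongr
  rw [h1, hp _ (by simpa using hmem), hp0]
  simp

/-- The Riesz representation theorem in `V_k`. -/
theorem existsUnique_l2inner_eq (hM : 1 ≤ M) {l : (ℝ → ℝ) → ℝ}
    (hadd : ∀ f ∈ dgSpace k M, ∀ g ∈ dgSpace k M, l (f + g) = l f + l g)
    (hsmul : ∀ (c : ℝ), ∀ f ∈ dgSpace k M, l (c • f) = c * l f) :
    ∃! v, v ∈ dgSpace k M ∧ ∀ φ ∈ dgSpace k M, l2inner v φ = l φ := by
  have := finiteDimensional_dgSpace k hM
  have hbm : ∀ u : dgSpace k M, IsBM (u : ℝ → ℝ) := fun u => IsBM.of_mem_dgSpace hM u.2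
  let B : dgSpace k M →ₗ[ℝ] Module.Dual ℝ (dgSpace k M) :=
    LinearMap.mk₂ ℝ (fun u v => l2inner u v)
      (fun u u' v => l2inner_add_left (hbm u) (hbm u') (hbm v))
      (fun c u v => l2inner_smul_left c u v)
      (fun u v v' => l2inner_add_right (hbm v) (hbm v') (hbm u))
      (fun c u v => l2inner_smul_right c u v)
  have hinj : Function.Injective B := by
    refine (injective_iff_map_eq_zero B).2 fun u hu => Subtype.ext ?_
    refine eq_zero_of_l2norm_eq_zero hM u.2 ?_
    have h1 : l2inner (u : ℝ → ℝ) u = 0 := LinearMap.congr_fun hu u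
    rw [← l2norm_sq] at h1
    exact pow_eq_zero_iff two_ne_zero |>.1 h1
  have hsurj : Function.Surjective B :=
    (LinearMap.injective_iff_surjective_of_finrank_eq_finrank
      Subspace.dual_finrank_eq.symm).1 hinj
  let L : Module.Dual ℝ (dgSpace k M) :=
    { toFun := fun φ => l φ
      map_add' := fun f g => hadd f f.2 g g.2
      map_smul' := fun c f => hsmul c f f.2 }
  obtain ⟨v, hv⟩ := hsurj L
  refine ⟨v, ⟨v.2, fun φ hφ => LinearMap.congr_fun hv ⟨φ, hφ⟩⟩, fun v' hv' => ?_⟩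
  have h2 : B ⟨v', hv'.1⟩ = B v := by
    rw [hv]
    exact LinearMap.ext fun φ => hv'.2 φ φ.2
  exact congrArg Subtype.val (hinj h2)

theorem existsUnique_l2inner_eq_l2inner (k : ℕ) (hM : 1 ≤ M) {w : ℝ → ℝ} (hw : IsBM w) :
    ∃! v, v ∈ dgSpace k M ∧ ∀ φ ∈ dgSpace k M, l2inner v φ = l2inner w φ :=
  existsUnique_l2inner_eq hM
    (fun _ hf _ hg => l2inner_add_right (.of_mem_dgSpace hM hf) (.of_mem_dgSpace hM hg) hw)
    (fun c f _ => l2inner_smul_right c w f)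

/-- The projection is characterised by the Galerkin orthogonality. -/
theorem isProj_iff (hM : 1 ≤ M) {w : ℝ → ℝ} (hw : IsBM w) (v : ℝ → ℝ) :
    IsProj k M w v ↔ v ∈ dgSpace k M ∧ ∀ φ ∈ dgSpace k M, l2inner v φ = l2inner w φ := by
  have pyth : ∀ v f, v ∈ dgSpace k M → (∀ φ ∈ dgSpace k M, l2inner v φ = l2inner w φ) →
      f ∈ dgSpace k M → l2norm (w - f) ^ 2 = l2norm (w - v) ^ 2 + l2norm (v - f) ^ 2 := by
    intro v f hv hvo hf
    have hvm := IsBM.of_mem_dgSpace hM hv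
    have hfm := IsBM.of_mem_dgSpace hM hf
    rw [l2norm_sub_sq hw hfm, l2norm_sub_sq hw hvm, l2norm_sub_sq hvm hfm, hvo f hf, ← hvo v hv,
      l2norm_sq v]
    ring
  constructor
  · rintro ⟨hv, hmin⟩
    -- A minimiser is compared with the Galerkin solution v₀: by Pythagoras it is at distance 0 from
    -- it.
    obtain ⟨v₀, ⟨hv₀, ho⟩, -⟩ := existsUnique_l2inner_eq_l2inner k hM hw
    have h1 := pyth v₀ v hv₀ ho hv
    have h2 := pow_le_pow_left₀ (l2norm_nonneg _) (hmin v₀ hv₀) 2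
    have h3 : l2norm (v₀ - v) = 0 :=
      pow_eq_zero_iff two_ne_zero |>.1 (le_antisymm (by linarith) (sq_nonneg _))
    have h4 := eq_zero_of_l2norm_eq_zero hM ((dgSpace k M).sub_mem hv₀ hv) h3
    rw [← sub_eq_zero.1 h4]
    exact ⟨hv₀, ho⟩
  · rintro ⟨hv, ho⟩
    refine ⟨hv, fun f hf => ?_⟩
    have h1 := pyth v f hv ho hf
    refine le_of_sq_le_sq ?_ (l2norm_nonneg _)
    linarith [sq_nonneg (l2norm (v - f))]

theorem existsUnique_isProj (k : ℕ) (hM : 1 ≤ M) {w : ℝ → ℝ} (hw : IsBM w) :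
    ∃! v, IsProj k M w v := by
  simp only [isProj_iff hM hw]
  exact existsUnique_l2inner_eq_l2inner k hM hw

/-! ### From bilinear forms to operators -/

theorem gaussForm_add_right {y : ℝ → ℝ} (P : Partition M y) (f g w : ℝ → ℝ) :
    gaussForm k P w (f + g) = gaussForm k P w f + gaussForm k P w g := by
  simp only [gaussForm, ← Finset.sum_add_distrib, Pi.add_apply, mul_add]

theorem gaussForm_smul_right {y : ℝ → ℝ} (P : Partition M y) (c : ℝ) (f w : ℝ → ℝ) :
    gaussForm k P w (c • f) = c * gaussForm k P w f := by
  simp only [gaussForm, Finset.mul_sum, Pi.smul_apply, smul_eq_mul]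
  exact Finset.sum_congr rfl fun _ _ => Finset.sum_congr rfl fun _ _ => by ring

theorem gaussForm_add_left {y : ℝ → ℝ} (P : Partition M y) (f g w : ℝ → ℝ) :
    gaussForm k P (f + g) w = gaussForm k P f w + gaussForm k P g w := by
  simp only [gaussForm, ← Finset.sum_add_distrib, Pi.add_apply, mul_add, add_mul]

variable {s : Scheme}

theorem existsUnique_isQuadImage (hM : 1 ≤ M) (P : ∀ q : s.nodes, Partition M (s.char b σ h q))
    (w : ℝ → ℝ) : ∃! v, s.IsQuadImage b σ h k M P w v := by
  refine existsUnique_l2inner_eq hM (fun f _ g _ => ?_) (fun c f _ => ?_)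
  · simp only [gaussForm_add_right, mul_add, Finset.sum_add_distrib]
  · simp only [gaussForm_smul_right, Finset.mul_sum]
    exact Finset.sum_congr rfl fun _ _ => by ring

theorem Scheme.weight_nonneg (s : Scheme) (q : ℤ) : 0 ≤ s.weight q := by
  cases s with
  | one => norm_num [Scheme.weight]
  | two => simp only [Scheme.weight]; split_ifs <;> norm_num

theorem Scheme.sum_weight (s : Scheme) : ∑ q : s.nodes, s.weight q = 1 := by
  rw [Finset.sum_coe_sort s.nodes s.weight]
  cases s with
  | one => simp [Scheme.nodes, Scheme.weight]
  | two => simp [Scheme.nodes, Scheme.weight]; norm_num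

theorem IsBM.semiDiscrete {w : ℝ → ℝ} (hw : IsBM w)
    (hy : ∀ q ∈ s.nodes, Measurable (s.char b σ h q)) : IsBM (s.semiDiscrete b σ h w) :=
  IsBM.sum _ fun q _ => (hw.comp (hy q q.2)).const_mul _

theorem l2inner_semiDiscrete {w φ : ℝ → ℝ} (hw : IsBM w) (hφ : IsBM φ)
    (hy : ∀ q ∈ s.nodes, Measurable (s.char b σ h q)) :
    l2inner (s.semiDiscrete b σ h w) φ =
      ∑ q : s.nodes, s.weight q * l2inner (fun x => w (s.char b σ h q x)) φ := by
  simp only [l2inner, Scheme.semiDiscrete, Finset.sum_mul]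
  rw [intervalIntegral.integral_finsetSum fun (q : s.nodes) _ =>
    ((((hw.comp (hy q q.2)).const_mul _).mul hφ).intervalIntegrable _ _)]
  refine Finset.sum_congr rfl fun q _ => ?_
  rw [← intervalIntegral.integral_const_mul]
  simp only [mul_assoc]

/-- A bound on the quadrature errors of the bilinear forms bounds the error of the operator. -/
theorem l2norm_quadOp_sub_exactOp_le (hM : 1 ≤ M)
    (P : ∀ q : s.nodes, Partition M (s.char b σ h q))
    (hy : ∀ q ∈ s.nodes, Measurable (s.char b σ h q)) {w : ℝ → ℝ} (hw : IsBM w) {η : ℝ}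
    (herr : ∀ q : s.nodes, ∀ φ ∈ dgSpace k M,
      |gaussForm k (P q) (fun x => w (s.char b σ h q x)) φ
        - l2inner (fun x => w (s.char b σ h q x)) φ| ≤ η * l2norm φ) :
    l2norm (s.quadOp b σ h k M P w - s.exactOp b σ h k M w) ≤ η := by
  have h1 : s.IsQuadImage b σ h k M P w (s.quadOp b σ h k M P w) :=
    Classical.epsilon_spec (existsUnique_isQuadImage hM P w).exists
  have hsd := hw.semiDiscrete hy
  have h2 := (isProj_iff hM hsd _).1 (Classical.epsilon_spec (existsUnique_isProj k hM hsd).exists)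
  change s.exactOp b σ h k M w ∈ _ ∧ ∀ φ ∈ dgSpace k M, l2inner (s.exactOp b σ h k M w) φ = _ at h2
  have hη : 0 ≤ η := by
    obtain ⟨q⟩ : Nonempty s.nodes := by
      cases s
      · exact ⟨⟨1, by simp [Scheme.nodes]⟩⟩
      · exact ⟨⟨1, by simp [Scheme.nodes]⟩⟩
    have hone : (fun _ => 1 : ℝ → ℝ) ∈ dgSpace k M :=
      ⟨fun _ => rfl, fun _ _ => ⟨1, by simp, by simp⟩⟩
    have := (abs_nonneg _).trans (herr q _ hone)
    rwa [l2norm_const, abs_one, mul_one] at this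
  set d := s.quadOp b σ h k M P w - s.exactOp b σ h k M w with hd
  have hdV : d ∈ dgSpace k M := (dgSpace k M).sub_mem h1.1 h2.1
  have hdm := IsBM.of_mem_dgSpace hM hdV
  -- The difference d lies in V_k, so it is an admissible test function; the weights are nonnegative
  -- and sum to 1.
  have hsq : l2norm d ^ 2 ≤ η * l2norm d := by
    have e : l2norm d ^ 2 = ∑ q : s.nodes, s.weight q *
        (gaussForm k (P q) (fun x => w (s.char b σ h q x)) d
          - l2inner (fun x => w (s.char b σ h q x)) d) := by
      rw [l2norm_sq]
      nth_rw 1 [hd]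
      rw [l2inner_sub_left (.of_mem_dgSpace hM h1.1) (.of_mem_dgSpace hM h2.1) hdm,
        h1.2 d hdV, h2.2 d hdV, l2inner_semiDiscrete hw hdm hy, ← Finset.sum_sub_distrib]
      simp only [mul_sub]
    rw [e]
    calc _ ≤ ∑ q : s.nodes, s.weight q * (η * l2norm d) := by
          refine Finset.sum_le_sum fun q _ => mul_le_mul_of_nonneg_left ?_ (s.weight_nonneg q)
          exact (le_abs_self _).trans (herr q d hdV)
      _ = _ := by rw [← Finset.sum_mul, s.sum_weight, one_mul]
  rcases (l2norm_nonneg d).eq_or_lt with h0 | hpos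
  · rw [← h0]; exact hη
  · rw [pow_two] at hsq
    exact le_of_mul_le_mul_right hsq hpos

end SLDG

/-! ### The main theorem -/

open SLDG
theorem mainTheorem7 (s : Scheme) (k : ℕ) (b σ : ℝ → ℝ)
    (hb : ContDiff ℝ (2 * k + 2 : ℕ) b) (hσ : ContDiff ℝ (2 * k + 2 : ℕ) σ)
    (hbper : Function.Periodic b 1) (hσper : Function.Periodic σ 1)
    (θ : ℝ) (hθ : θ < 1) :
    ∃ C : ℝ, 0 ≤ C ∧ ∀ (M : ℕ) (Δx Δt : ℝ), 1 ≤ M → Δx = 1 / M → 0 < Δt →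
      s.SmallStep b σ Δt θ →
      -- the partitions used by the quadrature exist
      (∀ q : s.nodes, Nonempty (Partition M (s.char b σ Δt q))) ∧
      ∀ P : ∀ q : s.nodes, Partition M (s.char b σ Δt q),
        -- the operators `S` and `S̃` are well defined
        (∀ u ∈ dgSpace k M, ∀ ψ : ℝ → ℝ, ContDiff ℝ (k + 1 : ℕ) ψ → Function.Periodic ψ 1 →
          (∃! v, IsProj k M (s.semiDiscrete b σ Δt (u - ψ)) v) ∧
          (∃! v, s.IsQuadImage b σ Δt k M P (u - ψ) v)) ∧
        -- (i)
        (∀ q : s.nodes, ∀ u ∈ dgSpace k M, ∀ φ ∈ dgSpace k M,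
          |gaussForm k (P q) (fun x => u (s.char b σ Δt q x)) φ
              - l2inner (fun x => u (s.char b σ Δt q x)) φ|
            ≤ C * √Δt * Δx ^ 2 * l2norm u * l2norm φ) ∧
        (∀ u ∈ dgSpace k M,
          l2norm (s.quadOp b σ Δt k M P u - s.exactOp b σ Δt k M u)
            ≤ C * √Δt * Δx ^ 2 * l2norm u) ∧
        -- (ii)
        (∀ u ∈ dgSpace k M, ∀ ψ : ℝ → ℝ, ContDiff ℝ (k + 1 : ℕ) ψ → Function.Periodic ψ 1 →
          l2norm (s.quadOp b σ Δt k M P (u - ψ) - s.exactOp b σ Δt k M (u - ψ))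
            ≤ C * √Δt * Δx ^ 2 * l2norm (u - ψ) + C * derivBound (k + 1) ψ * Δx ^ (k + 1)) ∧
        -- (iii)
        (∀ ψ : ℝ → ℝ, ContDiff ℝ (k + 1 : ℕ) ψ → Function.Periodic ψ 1 →
          l2norm (s.quadOp b σ Δt k M P ψ - s.exactOp b σ Δt k M ψ)
            ≤ C * derivBound (k + 1) ψ * Δx ^ (k + 1)) := by
  have hbc : IsCoeff (2 * k + 2) b := ⟨hb, hbper, by omega⟩
  have hσc : IsCoeff (2 * k + 2) σ := ⟨hσ, hσper, by omega⟩
  obtain ⟨D, hD, hgood⟩ := exists_isGoodChar s hbc hσc hθ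
  have hD0 : 0 ≤ D := zero_le_one.trans hD
  have hc : 0 < 1 - θ := sub_pos.2 hθ
  obtain ⟨K₁, hK₁, h1⟩ := exists_comp_gaussForm_error_le k hc D
  obtain ⟨K₂, hK₂, h2⟩ := exists_gaussForm_error_le_of_abs_le k
  obtain ⟨K₃, hK₃, h3⟩ := exists_smooth_gaussForm_error_le k (1 - θ) D hD
  refine ⟨K₁ * D + K₂ + K₃, by positivity, ?_⟩
  rintro M _ Δt hM rfl hΔt hstep
  have hM' : (0 : ℝ) < M := by exact_mod_cast hM
  have hM1 : 1 / (M : ℝ) ≤ 1 := by rw [div_le_one hM']; exact_mod_cast hM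
  obtain ⟨ε, hε, hεD, hεt, hy⟩ := hgood Δt hΔt hstep
  have hmeas : ∀ q ∈ s.nodes, Measurable (s.char b σ Δt q) := fun q hq => (hy q hq).measurable
  have hsq : 0 ≤ √Δt := Real.sqrt_nonneg _
  -- Both bounds on ε are used: ε ≤ D √Δt for the terms in ‖u‖ or ‖u - ψ‖, and later ε ≤ D for the
  -- term in η, where no √Δt is wanted.
  have hK₁ε : K₁ * ε ≤ (K₁ * D + K₂ + K₃) * √Δt := by
    have e1 := mul_le_mul_of_nonneg_left hεt hK₁
    have e2 : 0 ≤ (K₂ + K₃) * √Δt := by positivity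
    linarith
  refine ⟨fun q => nonempty_partition hM
    (strictMono_of_deriv_pos fun x => hc.trans_le ((hy q q.2).le_deriv x))
    (hy q q.2).differentiable.continuous, fun P => ?_⟩
  have hi : ∀ q : s.nodes, ∀ u ∈ dgSpace k M, ∀ φ ∈ dgSpace k M,
      |gaussForm k (P q) (fun x => u (s.char b σ Δt q x)) φ
        - l2inner (fun x => u (s.char b σ Δt q x)) φ|
      ≤ (K₁ * D + K₂ + K₃) * √Δt * (1 / (M : ℝ)) ^ 2 * l2norm u * l2norm φ := by
    intro q u hu φ hφ
    refine (h1 ε _ hε hεD (hy q q.2) M (P q) u φ hM hu hφ).trans ?_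
    have := l2norm_nonneg u
    have := l2norm_nonneg φ
    gcongr
  have hψm : ∀ ψ : ℝ → ℝ, ContDiff ℝ (k + 1 : ℕ) ψ → Function.Periodic ψ 1 → IsBM ψ :=
    fun ψ hψ hψp => .of_continuous_periodic hψ.continuous hψp
  refine ⟨fun u hu ψ hψ hψp => ?_, hi, fun u hu => ?_, fun u hu ψ hψ hψp => ?_,
    fun ψ hψ hψp => ?_⟩
  · exact ⟨existsUnique_isProj k hM
      (((IsBM.of_mem_dgSpace hM hu).sub (hψm ψ hψ hψp)).semiDiscrete hmeas),
      existsUnique_isQuadImage hM P _⟩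
  · exact l2norm_quadOp_sub_exactOp_le hM P hmeas (.of_mem_dgSpace hM hu)
      fun q φ hφ => hi q u hu φ hφ
  · have hum := IsBM.of_mem_dgSpace hM hu
    have hw := hum.sub (hψm ψ hψ hψp)
    -- Replacing u by u - T stays in V_k, so (i) sees only ‖u - T‖ ≤ ‖u - ψ‖ + η and not ‖u‖.
    obtain ⟨T, hT, hTψ⟩ := exists_mem_dgSpace_abs_sub_le hM hψ hψp
    have hB := derivBound_nonneg hψ hψp
    set η := derivBound (k + 1) ψ * (1 / (M : ℝ)) ^ (k + 1) with hη
    have hη0 : 0 ≤ η := by positivity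
    have hTm := IsBM.of_mem_dgSpace hM hT
    have hdm := hTm.sub (hψm ψ hψ hψp)
    have hsplit : u - ψ = (u - T) + (T - ψ) := by abel
    have hnorm : l2norm (u - T) ≤ l2norm (u - ψ) + η := by
      have e : u - T = (u - ψ) + (fun x => -1 * (T - ψ) x) := by ext x; simp
      have e1 := l2norm_add_le hw (hdm.const_mul (-1))
      rw [← e, l2norm_const_mul, abs_neg, abs_one, one_mul] at e1
      have e2 := l2norm_mono hdm (IsBM.const η) hTψ
      rw [l2norm_const, abs_of_nonneg hη0] at e2
      linarith
    refine l2norm_quadOp_sub_exactOp_le hM P hmeas hw fun q φ hφ => ?_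
    have hφm := IsBM.of_mem_dgSpace hM hφ
    have hφ0 := l2norm_nonneg φ
    have hyq := hmeas q q.2
    have e1 := h1 ε _ hε hεD (hy q q.2) M (P q) (u - T) φ hM ((dgSpace k M).sub_mem hu hT) hφ
    have e2 := h2 M _ (P q) (fun x => (T - ψ) (s.char b σ Δt q x)) φ η hM (hdm.comp hyq) hφ
      fun x => hTψ _
    have e3 : (fun x => (u - ψ) (s.char b σ Δt q x)) =
        (fun x => (u - T) (s.char b σ Δt q x)) + fun x => (T - ψ) (s.char b σ Δt q x) := by
      ext x; simp
    rw [e3, gaussForm_add_left, l2inner_add_left ((hum.sub hTm).comp hyq) (hdm.comp hyq) hφm,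
      add_sub_add_comm]
    refine (abs_add_le _ _).trans ((add_le_add e1 e2).trans ?_)
    rw [← add_mul]
    refine mul_le_mul_of_nonneg_right ?_ hφ0
    have hu0 := l2norm_nonneg (u - ψ)
    calc _ ≤ K₁ * ε * (1 / (M : ℝ)) ^ 2 * (l2norm (u - ψ) + η) + K₂ * η := by gcongr
      _ = K₁ * ε * (1 / (M : ℝ)) ^ 2 * l2norm (u - ψ) +
          (K₁ * ε * (1 / (M : ℝ)) ^ 2 + K₂) * η := by ring
      _ ≤ (K₁ * D + K₂ + K₃) * √Δt * (1 / (M : ℝ)) ^ 2 * l2norm (u - ψ) +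
          (K₁ * D * 1 ^ 2 + K₂ + K₃) * η := by
        refine add_le_add (by gcongr) (mul_le_mul_of_nonneg_right ?_ hη0)
        refine (add_le_add_left ?_ K₂).trans (le_add_of_nonneg_right hK₃)
        gcongr
      _ = _ := by rw [hη]; ring
  · have hB := derivBound_nonneg hψ hψp
    refine l2norm_quadOp_sub_exactOp_le hM P hmeas (hψm ψ hψ hψp) fun q φ hφ => ?_
    refine (h3 ε _ (hy q q.2) M (P q) ψ φ hM hψ hψp hφ).trans ?_
    have := l2norm_nonneg φ
    gcongr
    have : 0 ≤ K₁ * D + K₂ := by positivity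
    linarith
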